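/- Let $G$ be a complex Lie group whose Lie algebra $\mathfrak g$ is semisimple, and let $\mathfrak g=\bigoplus_{m\in\mathbb Z}\mathfrak g_m$ be a $\mathbb Z$-gradation, $[\mathfrak g_m,\mathfrak g_k]\subset\mathfrak g_{m+k}$. Put $$\tilde{\mathfrak b}_-=\bigoplus_{m\le 0}\mathfrak g_m,\qquad \tilde{\mathfrak b}_+=\bigoplus_{m\ge 0}\mathfrak g_m,\qquad \tilde{\mathfrak m}_+=\bigoplus_{m\le 1}\mathfrak g_m,\qquad \tilde{\mathfrak m}_-=\bigoplus_{m\ge -1}\mathfrak g_m .$$ Let $\tilde B_\pm\subset G$ be the connected subgroups with Lie algebras $\tilde{\mathfrak b}_\pm$, let $F_\pm=G/\tilde B_\mp$ be the corresponding flag manifolds with their natural complex structure, and let $\pi_\pm:G\to F_\pm$ be the projections. Identify $\mathfrak g$ with the holomorphic tangent space $T^{(1,0)}_e(G)$, let $L_g$ be the left translation by $g\in G$, and let $\theta$ be the holomorphic ($\mathfrak g$-valued, type $(1,0)$) Maurer–Cartan form of $G$. Let $\mathcal M_\pm$ be the holomorphic distribution on $F_\pm$ given by $$\mathcal M_{\pm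 q}=\pi_{\pm *}\bigl(L_{g*}(\tilde{\mathfrak m}_\pm)\bigr)\subset T^{(1,0)}_q(F_\pm)\qquad\text{for any } g\in G \text{ with } \pi_\pm(g)=q .$$ Let $M$ be a one-dimensional complex manifold, let $\varphi:M\to G$ be a smooth map, and put $\varphi_\pm=\pi_\pm\circ\varphi:M\to F_\pm$. Then the following are equivalent. 1. The $(1,0)$-component of the $\mathfrak g$-valued 1-form $\varphi^*\theta$ takes values in $\mathfrak g_{-1}\oplus\mathfrak g_0$, and its $(0,1)$-component takes values in $\mathfrak g_0\oplus\mathfrak g_{+1}$. 2. The map $\varphi_-$ is holomorphic and $\varphi_{-*}(\partial_{z\,p})\in\mathcal M_{-\varphi_-(p)}$, and the map $\varphi_+$ is antiholomorphic and $\varphi_{+*}(\partial_{\bar z\,p})\in\mathcal M_{+\varphi_+(p)}$, for every $p\in M$ and every local holomorphic coordinate $z$ of $M$ around $p$. -/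

import Mathlib

open scoped Manifold ContDiff TensorProduct

noncomputable section

namespace Toda

section ComplexTangent

/-! Complex manifolds are modelled on a complex normed space `V` (model with corners `𝓘(ℂ, V)`);
the underlying real manifold has the same charts and the model `𝓘(ℝ, V)`. -/

variable (V : Type*) [NormedAddCommGroup V] [NormedSpace ℂ V]
  {X : Type*} [TopologicalSpace X] [ChartedSpace V X]
  (W : Type*) [NormedAddCommGroup W] [NormedSpace ℂ W]
  {Y : Type*} [TopologicalSpace Y] [ChartedSpace W Y]

/-- The complexification of the real tangent space of `X` at `x`. -/
abbrev CTangent (x : X) : Type _ := ℂ ⊗[ℝ] TangentSpace 𝓘(ℝ, V) x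

/-- The complex structure on the real tangent space. The tangent space at `x` is `V`, read in the
chart at `x`, and multiplication by `i` does not depend on the holomorphic chart. -/
def complexStructure (x : X) : TangentSpace 𝓘(ℝ, V) x →ₗ[ℝ] TangentSpace 𝓘(ℝ, V) x :=
  ((Complex.I • (LinearMap.id : V →ₗ[ℂ] V)).restrictScalars ℝ : V →ₗ[ℝ] V)

/-- The tangent space of a complex manifold, as the tangent space of the underlying real manifold. -/
def realTangent (x : X) : TangentSpace 𝓘(ℂ, V) x →ₗ[ℝ] TangentSpace 𝓘(ℝ, V) x :=
  (LinearMap.id : V →ₗ[ℝ] V)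

/-- The projection `(1/2) (id - i J)` onto the `(1,0)`-vectors. -/
def proj10 (x : X) : CTangent V x →ₗ[ℂ] CTangent V x :=
  (1 / 2 : ℂ) • (LinearMap.id - Complex.I • (complexStructure V x).baseChange ℂ)

theorem projI_one_tmul_smul (c : ℂ) (v : V) :
    ((1 / 2 : ℂ) • (LinearMap.id - Complex.I •
        ((Complex.I • (LinearMap.id : V →ₗ[ℂ] V)).restrictScalars ℝ).baseChange ℂ) :
      ℂ ⊗[ℝ] V →ₗ[ℂ] ℂ ⊗[ℝ] V) (1 ⊗ₜ[ℝ] (c • v)) =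
    c • ((1 / 2 : ℂ) • (LinearMap.id - Complex.I •
        ((Complex.I • (LinearMap.id : V →ₗ[ℂ] V)).restrictScalars ℝ).baseChange ℂ) :
      ℂ ⊗[ℝ] V →ₗ[ℂ] ℂ ⊗[ℝ] V) (1 ⊗ₜ[ℝ] v) := by
  have hr : ∀ (r : ℝ) (w : V), (1 : ℂ) ⊗ₜ[ℝ] (r • w) = (r : ℂ) • ((1 : ℂ) ⊗ₜ[ℝ] w) := by
    intro r w
    rw [TensorProduct.tmul_smul]
    rfl
  have hv : c • v = c.re • v + c.im • (Complex.I • v) := by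
    conv_lhs => rw [← Complex.re_add_im c]
    rw [add_smul, mul_smul]
    rfl
  have hI : Complex.I • c • v = c.re • (Complex.I • v) + c.im • (-v) := by
    rw [hv, smul_add, smul_comm Complex.I c.re, smul_comm Complex.I c.im, smul_smul Complex.I,
      Complex.I_mul_I, neg_one_smul]
  have hc : c = c.re + c.im * Complex.I := (Complex.re_add_im c).symm
  simp only [LinearMap.smul_apply, LinearMap.sub_apply, LinearMap.id_apply,
    LinearMap.baseChange_tmul, LinearMap.restrictScalars_apply, hI]
  rw [hv]
  simp only [TensorProduct.tmul_add, hr, TensorProduct.tmul_neg]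
  generalize (1 : ℂ) ⊗ₜ[ℝ] v = a
  generalize (1 : ℂ) ⊗ₜ[ℝ] (Complex.I • v) = b
  conv_rhs => rw [hc]
  have h2 := Complex.I_mul_I
  match_scalars
  · ring
  · linear_combination (c.im / 2 : ℂ) * h2

/-- The projection `(1/2) (id + i J)` onto the `(0,1)`-vectors. -/
def proj01 (x : X) : CTangent V x →ₗ[ℂ] CTangent V x :=
  (1 / 2 : ℂ) • (LinearMap.id + Complex.I • (complexStructure V x).baseChange ℂ)

/-- The complexified differential of a (real differentiable) map at `x`. -/
def pushforward (f : X → Y) (x : X) : CTangent V x →ₗ[ℂ] CTangent W (f x) :=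
  (mfderiv 𝓘(ℝ, V) 𝓘(ℝ, W) f x).toLinearMap.baseChange ℂ

/-- The derivative of a (real differentiable) complex-valued function along complexified tangent
vectors at `x`. -/
def derivAlong (h : X → ℂ) (x : X) : CTangent V x →ₗ[ℂ] ℂ :=
  (mvfderiv 𝓘(ℝ, V) h x).toLinearMap.liftBaseChange ℂ

theorem derivAlong_add {h k : X → ℂ} {x : X} (hh : MDifferentiableAt 𝓘(ℝ, V) 𝓘(ℝ, ℂ) h x)
    (hk : MDifferentiableAt 𝓘(ℝ, V) 𝓘(ℝ, ℂ) k x) :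
    derivAlong V (h + k) x = derivAlong V h x + derivAlong V k x := by
  ext v
  simpa [derivAlong, mvfderiv] using!
    DFunLike.congr_fun (hh.hasMFDerivAt.add hk.hasMFDerivAt).mfderiv v

theorem derivAlong_mul {h k : X → ℂ} {x : X} (hh : MDifferentiableAt 𝓘(ℝ, V) 𝓘(ℝ, ℂ) h x)
    (hk : MDifferentiableAt 𝓘(ℝ, V) 𝓘(ℝ, ℂ) k x) :
    derivAlong V (h * k) x = h x • derivAlong V k x + k x • derivAlong V h x := by
  ext v
  simpa [derivAlong, mvfderiv] using!
    DFunLike.congr_fun (hh.hasMFDerivAt.mul hk.hasMFDerivAt).mfderiv v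

theorem derivAlong_const (c : ℂ) (x : X) : derivAlong V (fun _ : X => c) x = 0 := by
  ext v
  simp [derivAlong, mvfderiv, mfderiv_const]

end ComplexTangent

section Coordinates

variable {M : Type*} [TopologicalSpace M] [ChartedSpace ℂ M]

/-- The real coordinate vectors of the chart `z = e` at `p ∈ e.source`: `realCoord e p 1` is
`∂/∂x` and `realCoord e p i` is `∂/∂y`, where `z = x + i y`. -/
def realCoord (e : OpenPartialHomeomorph M ℂ) (p : M) (a : ℂ) : TangentSpace 𝓘(ℝ, ℂ) p :=
  (mfderiv 𝓘(ℝ, ℂ) 𝓘(ℝ, ℂ) e.symm (e p) : ℂ →L[ℝ] ℂ) a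

/-- `∂_z = (1/2) (∂/∂x - i ∂/∂y)` at `p`, for the local coordinate `z = e`. -/
def dz (e : OpenPartialHomeomorph M ℂ) (p : M) : CTangent ℂ p :=
  (1 / 2 : ℂ) • ((1 : ℂ) ⊗ₜ[ℝ] realCoord e p 1 - Complex.I ⊗ₜ[ℝ] realCoord e p Complex.I)

/-- `∂_z̄ = (1/2) (∂/∂x + i ∂/∂y)` at `p`, for the local coordinate `z = e`. -/
def dzbar (e : OpenPartialHomeomorph M ℂ) (p : M) : CTangent ℂ p :=
  (1 / 2 : ℂ) • ((1 : ℂ) ⊗ₜ[ℝ] realCoord e p 1 + Complex.I ⊗ₜ[ℝ] realCoord e p Complex.I)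

end Coordinates

section Grading

variable {L : Type*} [LieRing L] [LieAlgebra ℂ L]

/-- A `ℤ`-gradation of a complex Lie algebra. -/
structure Gradation (L : Type*) [LieRing L] [LieAlgebra ℂ L] where
  piece : ℤ → Submodule ℂ L
  isInternal : DirectSum.IsInternal piece
  lie_mem : ∀ (m k : ℤ) (x y : L), x ∈ piece m → y ∈ piece k → ⁅x, y⁆ ∈ piece (m + k)

namespace Gradation

/-- The sum of the pieces whose degree lies in `S`. -/
def part (𝒜 : Gradation L) (S : Set ℤ) : Submodule ℂ L := ⨆ m ∈ S, 𝒜.piece m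

theorem lie_mem_part (𝒜 : Gradation L) {S : Set ℤ} (hS : ∀ m ∈ S, ∀ k ∈ S, m + k ∈ S)
    {x y : L} (hx : x ∈ 𝒜.part S) (hy : y ∈ 𝒜.part S) : ⁅x, y⁆ ∈ 𝒜.part S := by
  have key : ∀ m ∈ S, ∀ k ∈ S, ∀ x ∈ 𝒜.piece m, ∀ y ∈ 𝒜.piece k, ⁅x, y⁆ ∈ 𝒜.part S :=
    fun m hm k hk x hx y hy =>
      (le_iSup₂_of_le (m + k) (hS m hm k hk) le_rfl : 𝒜.piece (m + k) ≤ 𝒜.part S)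
        (𝒜.lie_mem m k x y hx hy)
  have h1 : ∀ m ∈ S, ∀ x ∈ 𝒜.piece m, 𝒜.part S ≤
      (𝒜.part S).comap (LieModule.toEnd ℂ L L x : L →ₗ[ℂ] L) := fun m hm x hx =>
    iSup₂_le fun k hk y hy => key m hm k hk x hx y hy
  have h2 : 𝒜.part S ≤ (𝒜.part S).comap ((LieModule.toEnd ℂ L L : L →ₗ[ℂ] L →ₗ[ℂ] L).flip y) :=
    iSup₂_le fun m hm x hx => h1 m hm x hx hy
  exact h2 hx

/-- The sum of the pieces of nonpositive degree, as a Lie subalgebra. -/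
def bMinus (𝒜 : Gradation L) : LieSubalgebra ℂ L :=
  { 𝒜.part {m | m ≤ 0} with
    lie_mem' := fun hx hy => 𝒜.lie_mem_part
      (fun m hm k hk => by simp only [Set.mem_ofPred_eq] at hm hk ⊢; omega) hx hy }

/-- The sum of the pieces of nonnegative degree, as a Lie subalgebra. -/
def bPlus (𝒜 : Gradation L) : LieSubalgebra ℂ L :=
  { 𝒜.part {m | 0 ≤ m} with
    lie_mem' := fun hx hy => 𝒜.lie_mem_part
      (fun m hm k hk => by simp only [Set.mem_ofPred_eq] at hm hk ⊢; omega) hx hy }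

/-- The sum of the pieces of degree at least `-1`. -/
def mMinus (𝒜 : Gradation L) : Submodule ℂ L := 𝒜.part {m | -1 ≤ m}

/-- The sum of the pieces of degree at most `1`. -/
def mPlus (𝒜 : Gradation L) : Submodule ℂ L := 𝒜.part {m | m ≤ 1}

end Gradation

end Grading

section Group

variable (E : Type*) [NormedAddCommGroup E] [NormedSpace ℂ E]
  {G : Type*} [TopologicalSpace G] [ChartedSpace E G] [Group G]

/-- The differential at the unit of the left translation by `g`; it takes values in the tangent
space at `g * 1 = g`. -/
def leftTranslation (g : G) : CTangent E (1 : G) →ₗ[ℂ] CTangent E g :=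
  pushforward E E (fun a : G => g * a) 1

/-- The holomorphic Maurer-Cartan form: the `(1,0)`-component of the left translation of a
complexified tangent vector at `g` to the unit `g⁻¹ * g = 1`. -/
def maurerCartan (g : G) : CTangent E g →ₗ[ℂ] CTangent E (1 : G) :=
  proj10 E (1 : G) ∘ₗ (pushforward E E (fun a : G => g⁻¹ * a) g : CTangent E g →ₗ[ℂ] _)

/-- The identification `x ↦ (1/2) (x - i J x)` of the complex Lie algebra of `G` with the
holomorphic tangent space at the unit. -/
def toHolomorphic : GroupLieAlgebra 𝓘(ℂ, E) G →ₗ[ℂ] CTangent E (1 : G) where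
  toFun x := proj10 E (1 : G) (1 ⊗ₜ[ℝ] realTangent E (1 : G) x)
  map_add' x y := by rw [← map_add, ← TensorProduct.tmul_add, map_add]
  map_smul' c x := projI_one_tmul_smul E c x

/-- The connected subgroup of `G` with Lie algebra `𝔥`, that is, the subgroup generated by
`exp 𝔥`: the elements `exp x = γ 1` where `γ` is the one-parameter subgroup with velocity
`x ∈ 𝔥`. -/
def connectedSubgroup [LieGroup 𝓘(ℂ, E) ω G] [CompleteSpace E]
    (𝔥 : LieSubalgebra ℂ (GroupLieAlgebra 𝓘(ℂ, E) G)) : Subgroup G :=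
  Subgroup.closure {g | ∃ x ∈ 𝔥, ∃ γ : ℝ → G, ContMDiff 𝓘(ℝ, ℝ) 𝓘(ℝ, E) ∞ γ ∧
    (∀ s t, γ (s + t) = γ s * γ t) ∧
    (mfderiv 𝓘(ℝ, ℝ) 𝓘(ℝ, E) γ 0 : ℝ →L[ℝ] E) 1 = realTangent E (1 : G) x ∧ γ 1 = g}

end Group

section Quotient

/-! For a complex Lie group `G` and a subgroup `B`, the homogeneous space `G ⧸ B` carries the
quotient topology and the quotient structure: a complex-valued function on an open subset of
`G ⧸ B` is smooth (holomorphic) if and only if its composition with the canonical projection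
`G → G ⧸ B` is. For closed `B` this is the structure sheaf of the natural (complex) manifold
structure of `G ⧸ B`, the one for which the projection is a holomorphic submersion. -/

variable (E : Type*) [NormedAddCommGroup E] [NormedSpace ℂ E]
  {G : Type*} [TopologicalSpace G] [ChartedSpace E G] [Group G] {B : Subgroup G}
  {V : Type*} [NormedAddCommGroup V] [NormedSpace ℂ V]
  {X : Type*} [TopologicalSpace X] [ChartedSpace V X]

/-- The function `h` is smooth on the subset `U` of `G ⧸ B`. -/
def SmoothFunOn (h : G ⧸ B → ℂ) (U : Set (G ⧸ B)) : Prop :=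
  ContMDiffOn 𝓘(ℝ, E) 𝓘(ℝ, ℂ) ∞ (fun g : G => h (g : G ⧸ B)) {g : G | (g : G ⧸ B) ∈ U}

/-- The function `h` is holomorphic on the subset `U` of `G ⧸ B`. -/
def HolomorphicFunOn (h : G ⧸ B → ℂ) (U : Set (G ⧸ B)) : Prop :=
  MDifferentiableOn 𝓘(ℂ, E) 𝓘(ℂ, ℂ) (fun g : G => h (g : G ⧸ B)) {g : G | (g : G ⧸ B) ∈ U}

/-- The algebra of the functions on `G ⧸ B` that are smooth near `q`. -/
def smoothNear (q : G ⧸ B) : Subalgebra ℂ (G ⧸ B → ℂ) where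
  carrier := {h | ∃ U, IsOpen U ∧ q ∈ U ∧ SmoothFunOn E h U}
  mul_mem' := by
    rintro h k ⟨U, hU, hq, hh⟩ ⟨U', hU', hq', hk⟩
    exact ⟨U ∩ U', hU.inter hU', ⟨hq, hq'⟩,
      (contDiff_mul (𝕜 := ℝ) (𝔸 := ℂ)).contMDiff.comp_contMDiffOn
        ((hh.mono fun _ hx => hx.1).prodMk_space (hk.mono fun _ hx => hx.2))⟩
  add_mem' := by
    rintro h k ⟨U, hU, hq, hh⟩ ⟨U', hU', hq', hk⟩
    exact ⟨U ∩ U', hU.inter hU', ⟨hq, hq'⟩,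
      ContMDiffOn.add (hh.mono fun _ hx => hx.1) (hk.mono fun _ hx => hx.2)⟩
  algebraMap_mem' c := ⟨Set.univ, isOpen_univ, trivial, contMDiffOn_const⟩

/-- The complexified tangent space of `G ⧸ B` at `q`: the derivations at `q` of the algebra of
complex-valued functions smooth near `q`. -/
def QTangent (q : G ⧸ B) : Submodule ℂ (Module.Dual ℂ (smoothNear E q)) where
  carrier := {D | ∀ h k : smoothNear E q, D (h * k) = h.1 q * D k + k.1 q * D h}
  add_mem' := by
    intro D D' hD hD' h k
    simp only [LinearMap.add_apply, hD h k, hD' h k]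
    ring
  zero_mem' := by
    intro h k
    simp
  smul_mem' := by
    intro c D hD h k
    simp only [LinearMap.smul_apply, hD h k, smul_eq_mul]
    ring

variable (V) in
/-- A smooth map into `G ⧸ B`. -/
def SmoothMap (f : X → G ⧸ B) : Prop :=
  Continuous f ∧ ∀ p, ∀ h ∈ smoothNear E (f p), ContMDiffAt 𝓘(ℝ, V) 𝓘(ℝ, ℂ) ∞ (fun x => h (f x)) p

variable (V) in
/-- A holomorphic map into `G ⧸ B`. -/
def HolomorphicMap (f : X → G ⧸ B) : Prop :=
  Continuous f ∧ ∀ U : Set (G ⧸ B), IsOpen U → ∀ h : G ⧸ B → ℂ, HolomorphicFunOn E h U →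
    MDifferentiableOn 𝓘(ℂ, V) 𝓘(ℂ, ℂ) (fun x => h (f x)) (f ⁻¹' U)

variable (V) in
/-- An antiholomorphic map into `G ⧸ B`: holomorphic functions pull back to complex conjugates of
holomorphic functions. -/
def AntiholomorphicMap (f : X → G ⧸ B) : Prop :=
  Continuous f ∧ ∀ U : Set (G ⧸ B), IsOpen U → ∀ h : G ⧸ B → ℂ, HolomorphicFunOn E h U →
    MDifferentiableOn 𝓘(ℂ, V) 𝓘(ℂ, ℂ) (fun x => (starRingEnd ℂ) (h (f x))) (f ⁻¹' U)

variable {E}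

theorem SmoothMap.mdiff {f : X → G ⧸ B} (hf : SmoothMap E V f) {p : X} {q : G ⧸ B} (hq : f p = q)
    (h : smoothNear E q) : MDifferentiableAt 𝓘(ℝ, V) 𝓘(ℝ, ℂ) (fun x => h.1 (f x)) p := by
  subst hq
  exact (hf.2 p h.1 h.2).mdifferentiableAt (by simp)

/-- The complexified differential at `p` of a smooth map `f` into `G ⧸ B` with `f p = q`: the
vector `x` goes to the derivation `h ↦ x (h ∘ f)`. -/
def SmoothMap.pushforward {f : X → G ⧸ B} (hf : SmoothMap E V f) (p : X) (q : G ⧸ B)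
    (hq : f p = q) : CTangent V p →ₗ[ℂ] QTangent E q where
  toFun x := ⟨
    { toFun := fun h => derivAlong V (fun y => h.1 (f y)) p x
      map_add' := fun h k => DFunLike.congr_fun (derivAlong_add V (hf.mdiff hq h) (hf.mdiff hq k)) x
      map_smul' := fun c h => by
        have := DFunLike.congr_fun (derivAlong_mul V (h := fun _ => c) mdifferentiableAt_const
          (hf.mdiff hq h)) x
        rw [derivAlong_const] at this
        simpa using! this },
    fun h k => by
      subst hq
      exact DFunLike.congr_fun (derivAlong_mul V (hf.mdiff rfl h) (hf.mdiff rfl k)) x⟩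
  map_add' x y := by
    ext h
    exact map_add (derivAlong V (fun y => h.1 (f y)) p) x y
  map_smul' c x := by
    ext h
    exact map_smul (derivAlong V (fun y => h.1 (f y)) p) c x

theorem SmoothMap.mk_comp {φ : X → G} (hφ : ContMDiff 𝓘(ℝ, V) 𝓘(ℝ, E) ∞ φ) (B : Subgroup G) :
    SmoothMap E V (fun x => (φ x : G ⧸ B)) := by
  refine ⟨QuotientGroup.continuous_mk.comp hφ.continuous, fun p h hh => ?_⟩
  obtain ⟨U, hU, hq, hh⟩ := hh
  exact (hh.contMDiffAt ((hU.preimage QuotientGroup.continuous_mk).mem_nhds hq)).comp p (hφ p)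

theorem SmoothMap.mk (B : Subgroup G) : SmoothMap E E (fun g : G => (g : G ⧸ B)) :=
  SmoothMap.mk_comp contMDiff_id B

/-- The holomorphic distribution on `G ⧸ B` defined by a subspace `𝔪` of the Lie algebra of `G`:
its value at `q` is the image of `𝔪` under the left translation by any `g` that lies over `q`,
followed by the differential of the projection. (The image does not depend on `g` if `𝔪` is
invariant under the adjoint action of `B`.) -/
def distribution (𝔪 : Submodule ℂ (GroupLieAlgebra 𝓘(ℂ, E) G)) (q : G ⧸ B) :
    Submodule ℂ (QTangent E q) :=
  ⨆ (g : G) (hg : (g : G ⧸ B) = q),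
    𝔪.map ((SmoothMap.mk B).pushforward g q hg ∘ₗ leftTranslation E g ∘ₗ toHolomorphic E)

end Quotient

section Connection

variable {E : Type*} [NormedAddCommGroup E] [NormedSpace ℂ E]
  {G : Type*} [TopologicalSpace G] [ChartedSpace E G] [Group G]
  {M : Type*} [TopologicalSpace M] [ChartedSpace ℂ M]

/-- The connection form `φ^* θ`, where `θ` is the Maurer-Cartan form of `G`. -/
def connectionForm (φ : M → G) (p : M) : CTangent ℂ p →ₗ[ℂ] CTangent E (1 : G) :=
  maurerCartan E (φ p) ∘ₗ pushforward ℂ E φ p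

/-- The grading condition: the `(1,0)`-component of the form `α` takes values in `𝔤₋₁ ⊕ 𝔤₀`, and
its `(0,1)`-component takes values in `𝔤₀ ⊕ 𝔤₁`. -/
def GradingCondition [LieGroup 𝓘(ℂ, E) ω G] [CompleteSpace E]
    (𝒜 : Gradation (GroupLieAlgebra 𝓘(ℂ, E) G))
    (α : ∀ p : M, CTangent ℂ p →ₗ[ℂ] CTangent E (1 : G)) : Prop :=
  ∀ (p : M) (x : CTangent ℂ p),
    α p (proj10 ℂ p x) ∈ (𝒜.piece (-1) ⊔ 𝒜.piece 0).map (toHolomorphic E) ∧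
    α p (proj01 ℂ p x) ∈ (𝒜.piece 0 ⊔ 𝒜.piece 1).map (toHolomorphic E)

variable [LieGroup 𝓘(ℂ, E) ω G] [CompleteSpace E] (𝒜 : Gradation (GroupLieAlgebra 𝓘(ℂ, E) G))

/-- The flag manifold `F₋ = G / B₊`, where `B₊` is the connected subgroup with Lie algebra
`⨁_{m ≥ 0} 𝔤ₘ`. -/
abbrev FMinus : Type _ := G ⧸ connectedSubgroup E 𝒜.bPlus

/-- The flag manifold `F₊ = G / B₋`, where `B₋` is the connected subgroup with Lie algebra
`⨁_{m ≤ 0} 𝔤ₘ`. -/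
abbrev FPlus : Type _ := G ⧸ connectedSubgroup E 𝒜.bMinus

/-- The composition of `φ` with the projection `G → F₋`. -/
def phiMinus (φ : M → G) : M → FMinus 𝒜 := fun p => (φ p : FMinus 𝒜)

/-- The composition of `φ` with the projection `G → F₊`. -/
def phiPlus (φ : M → G) : M → FPlus 𝒜 := fun p => (φ p : FPlus 𝒜)

theorem phiMinus_smooth {φ : M → G} (hφ : ContMDiff 𝓘(ℝ, ℂ) 𝓘(ℝ, E) ∞ φ) :
    SmoothMap E ℂ (phiMinus 𝒜 φ) :=
  SmoothMap.mk_comp hφ _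

theorem phiPlus_smooth {φ : M → G} (hφ : ContMDiff 𝓘(ℝ, ℂ) 𝓘(ℝ, E) ∞ φ) :
    SmoothMap E ℂ (phiPlus 𝒜 φ) :=
  SmoothMap.mk_comp hφ _

end Connection

end Toda

end

/-! Left translation brings the differential of `φ` at `p` to the unit; the resulting real linear
map `logDeriv φ p` from `ℂ` to the Lie algebra is `z ↦ z a + z̄ c`, with `a = linPart` and `c =
conjPart`. Since the Maurer-Cartan form has type `(1,0)`, condition 1 says that `a ∈ 𝔤₋₁ ⊕ 𝔤₀` and
`c ∈ 𝔤₀ ⊕ 𝔤₁` at every point (`gradingCondition_iff`). These spaces are the intersections of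
`bMinus` with `mMinus` and of `bPlus` with `mPlus`. On the other side, `φ₋` is holomorphic iff `c ∈
bPlus`, and then `∂_z` is mapped into the distribution iff `a ∈ mMinus`; symmetrically, `φ₊` is
antiholomorphic iff `a ∈ bMinus`, and then the condition on `∂_z̄` says `c ∈ mPlus`. The four
memberships together are condition 1.

The quotients `G ⧸ B` are known only through their functions, so both criteria need two facts.
First, differentials of functions on `G ⧸ B` vanish on `𝔟`, because every element of `𝔟` is the
velocity of a one-parameter subgroup lying in `B` (`HasModelDerivAt.eq_zero_of_mem`). Second, there
are enough local holomorphic functions (`exists_holomorphic_function`). They come from the map `g ↦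
Ad(g) 𝔟` to the Grassmannian of the Lie algebra, which is constant on the cosets of `B`. A graph
coordinate near `𝔟`, evaluated at `H ∈ 𝔟` and paired with a functional `ξ` vanishing on `𝔟`, has
differential `x ↦ ξ ⁅x, H⁆` at the base point, because the differential of `Ad` is `ad`.

Semisimplicity supplies a suitable `H`: the derivation that multiplies `𝔤ₘ` by `m` is inner, so `⁅x,
H⁆ = -m x` on `𝔤ₘ` for some `H ∈ 𝔤₀`. Hence `⁅x, H⁆` lies in a sum of pieces including `𝔤₀` only if
`x` does, and the functions above detect `𝔟` and `𝔪` (`mem_of_forall_holomorphicFunOn`,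
`mem_distribution_iff`). -/

noncomputable section

namespace Toda

/-! ### Manifold derivatives as linear maps between the model spaces. -/

section ModelDerivative

variable (𝕜 : Type*) [NontriviallyNormedField 𝕜]
  {U : Type*} [NormedAddCommGroup U] [NormedSpace 𝕜 U]
  {Z : Type*} [TopologicalSpace Z] [ChartedSpace U Z]
  {V : Type*} [NormedAddCommGroup V] [NormedSpace 𝕜 V]
  {X : Type*} [TopologicalSpace X] [ChartedSpace V X]
  {W : Type*} [NormedAddCommGroup W] [NormedSpace 𝕜 W]
  {Y : Type*} [TopologicalSpace Y] [ChartedSpace W Y]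

/-- `f` has manifold derivative `f'` at `x`, where `f'` is a map of the model spaces. -/
def HasModelDerivAt (f : X → Y) (x : X) (f' : V →L[𝕜] W) : Prop :=
  HasMFDerivAt 𝓘(𝕜, V) 𝓘(𝕜, W) f x f'

/-- The manifold derivative as a map of the model spaces. -/
def modelDeriv (f : X → Y) (x : X) : V →L[𝕜] W :=
  (mfderiv 𝓘(𝕜, V) 𝓘(𝕜, W) f x :)

variable {𝕜}

theorem hasModelDerivAt_of_mdifferentiableAt {f : X → Y} {x : X}
    (h : MDifferentiableAt 𝓘(𝕜, V) 𝓘(𝕜, W) f x) :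
    HasModelDerivAt 𝕜 f x (modelDeriv 𝕜 f x : V →L[𝕜] W) :=
  h.hasMFDerivAt

namespace HasModelDerivAt

theorem mdifferentiableAt {f : X → Y} {x : X} {f' : V →L[𝕜] W} (h : HasModelDerivAt 𝕜 f x f') :
    MDifferentiableAt 𝓘(𝕜, V) 𝓘(𝕜, W) f x := HasMFDerivAt.mdifferentiableAt h

theorem continuousAt {f : X → Y} {x : X} {f' : V →L[𝕜] W} (h : HasModelDerivAt 𝕜 f x f') :
    ContinuousAt f x := h.mdifferentiableAt.continuousAt

theorem eq_modelDeriv {f : X → Y} {x : X} {f' : V →L[𝕜] W} (h : HasModelDerivAt 𝕜 f x f') :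
    modelDeriv 𝕜 f x = f' := HasMFDerivAt.mfderiv h

theorem unique {f : X → Y} {x : X} {f' f'' : V →L[𝕜] W} (h : HasModelDerivAt 𝕜 f x f')
    (h' : HasModelDerivAt 𝕜 f x f'') : f' = f'' :=
  h.eq_modelDeriv.symm.trans h'.eq_modelDeriv

theorem congr_of_eventuallyEq {f g : X → Y} {x : X} {f' : V →L[𝕜] W}
    (h : HasModelDerivAt 𝕜 f x f') (hfg : g =ᶠ[nhds x] f) : HasModelDerivAt 𝕜 g x f' :=
  HasMFDerivAt.congr_of_eventuallyEq h hfg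

theorem comp {g : X → Y} {f : Z → X} {z : Z} {x : X} {g' : V →L[𝕜] W} {f' : U →L[𝕜] V}
    (hg : HasModelDerivAt 𝕜 g x g') (hf : HasModelDerivAt 𝕜 f z f') (hx : f z = x) :
    HasModelDerivAt 𝕜 (fun y => g (f y)) z (g' ∘L f') := by
  subst hx
  exact HasMFDerivAt.comp z hg hf

theorem id (x : X) : HasModelDerivAt 𝕜 (fun y : X => y) x (ContinuousLinearMap.id 𝕜 V) :=
  hasMFDerivAt_id x

theorem const (y : Y) (x : X) : HasModelDerivAt 𝕜 (fun _ : X => y) x (0 : V →L[𝕜] W) :=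
  hasMFDerivAt_const y x

end HasModelDerivAt

theorem hasModelDerivAt_iff_hasFDerivAt {f : V → W} {x : V} {f' : V →L[𝕜] W} :
    HasModelDerivAt 𝕜 f x f' ↔ HasFDerivAt f f' x :=
  hasMFDerivAt_iff_hasFDerivAt

end ModelDerivative

/-! ### From complex to real differentiability and back. -/

section RestrictScalars

variable {V : Type*} [NormedAddCommGroup V] [NormedSpace ℂ V]
  {X : Type*} [TopologicalSpace X] [ChartedSpace V X]
  {W : Type*} [NormedAddCommGroup W] [NormedSpace ℂ W]
  {Y : Type*} [TopologicalSpace Y] [ChartedSpace W Y]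

theorem HasModelDerivAt.restrictScalars {f : X → Y} {x : X} {f' : V →L[ℂ] W}
    (h : HasModelDerivAt ℂ f x f') : HasModelDerivAt ℝ f x (f'.restrictScalars ℝ) := by
  refine ⟨h.continuousAt, ?_⟩
  exact HasFDerivWithinAt.restrictScalars ℝ h.2

theorem contMDiffOn_restrictScalars {n : WithTop ℕ∞} {f : X → Y} {s : Set X}
    (h : ContMDiffOn 𝓘(ℂ, V) 𝓘(ℂ, W) n f s) : ContMDiffOn 𝓘(ℝ, V) 𝓘(ℝ, W) n f s := by
  intro x hx
  obtain ⟨h1, h2⟩ := contMDiffWithinAt_iff.1 (h x hx)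
  exact contMDiffWithinAt_iff.2 ⟨h1, ContDiffWithinAt.restrict_scalars ℝ h2⟩

theorem contMDiff_restrictScalars {n : WithTop ℕ∞} {f : X → Y}
    (h : ContMDiff 𝓘(ℂ, V) 𝓘(ℂ, W) n f) : ContMDiff 𝓘(ℝ, V) 𝓘(ℝ, W) n f :=
  contMDiffOn_univ.1 (contMDiffOn_restrictScalars h.contMDiffOn)

theorem isManifold_restrictScalars (n : WithTop ℕ∞) [IsManifold 𝓘(ℂ, V) n X] :
    IsManifold 𝓘(ℝ, V) n X := by
  refine isManifold_of_contDiffOn _ _ _ fun e e' he he' => ?_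
  have := (contDiffGroupoid n 𝓘(ℂ, V)).compatible he he'
  exact ContDiffOn.restrict_scalars ℝ ((mem_groupoid_of_pregroupoid.1 this).1)

/-- A real differentiable function with complex linear derivative is complex differentiable. -/
theorem HasModelDerivAt.of_restrictScalars {f : X → Y} {x : X} {f' : V →L[ℝ] W}
    (h : HasModelDerivAt ℝ f x f') (g' : V →L[ℂ] W) (hg : g'.restrictScalars ℝ = f') :
    HasModelDerivAt ℂ f x g' := by
  refine ⟨h.continuousAt, ?_⟩
  exact HasFDerivWithinAt.of_restrictScalars ℝ h.2 hg

end RestrictScalars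
-- Vectors of type `(1,0)` and `(0,1)`; complex linear and conjugate linear parts.
section Complexification

variable {V : Type*} [NormedAddCommGroup V] [NormedSpace ℂ V]
  {W : Type*} [NormedAddCommGroup W] [NormedSpace ℂ W]

theorem one_tmul_real_smul (r : ℝ) (v : V) :
    (1 : ℂ) ⊗ₜ[ℝ] (r • v) = (r : ℂ) • ((1 : ℂ) ⊗ₜ[ℝ] v) := by
  rw [TensorProduct.tmul_smul]
  rfl

theorem tmul_eq_smul (c : ℂ) (v : V) : c ⊗ₜ[ℝ] v = c • ((1 : ℂ) ⊗ₜ[ℝ] v) := by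
  rw [TensorProduct.smul_tmul', smul_eq_mul, mul_one]

/-- The `(1,0)`-vector `(1/2) (v - i J v)` of a complex vector space. -/
def holVec (v : V) : ℂ ⊗[ℝ] V :=
  (1 / 2 : ℂ) • ((1 : ℂ) ⊗ₜ[ℝ] v - Complex.I • ((1 : ℂ) ⊗ₜ[ℝ] (Complex.I • v)))

/-- The `(0,1)`-vector `(1/2) (v + i J v)` of a complex vector space. -/
def antiholVec (v : V) : ℂ ⊗[ℝ] V :=
  (1 / 2 : ℂ) • ((1 : ℂ) ⊗ₜ[ℝ] v + Complex.I • ((1 : ℂ) ⊗ₜ[ℝ] (Complex.I • v)))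

theorem smul_eq_re_add_im (c : ℂ) (v : V) : c • v = c.re • v + c.im • (Complex.I • v) := by
  conv_lhs => rw [← Complex.re_add_im c]
  rw [add_smul, mul_smul]
  rfl

theorem I_smul_smul (c : ℂ) (v : V) :
    Complex.I • c • v = c.re • (Complex.I • v) + c.im • (-v) := by
  rw [smul_eq_re_add_im c, smul_add, smul_comm Complex.I c.re, smul_comm Complex.I c.im,
    smul_smul Complex.I, Complex.I_mul_I, neg_one_smul]

/-- On `(1,0)`-vectors `J` acts as the scalar `i`, so `Re c + (Im c) J` acts as `c`; on
`(0,1)`-vectors `J` acts as `-i`, whence the conjugate in `antiholVec_smul`. -/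
theorem holVec_smul (c : ℂ) (v : V) : holVec (c • v) = c • holVec v := by
  simp only [holVec, I_smul_smul]
  rw [smul_eq_re_add_im c]
  simp only [TensorProduct.tmul_add, one_tmul_real_smul, TensorProduct.tmul_neg]
  generalize (1 : ℂ) ⊗ₜ[ℝ] v = a
  generalize (1 : ℂ) ⊗ₜ[ℝ] (Complex.I • v) = b
  conv_rhs => rw [← Complex.re_add_im c]
  have h2 := Complex.I_mul_I
  match_scalars
  · ring
  · linear_combination (c.im / 2 : ℂ) * h2

theorem antiholVec_smul (c : ℂ) (v : V) :
    antiholVec (c • v) = (starRingEnd ℂ) c • antiholVec v := by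
  simp only [antiholVec, I_smul_smul]
  rw [smul_eq_re_add_im c]
  simp only [TensorProduct.tmul_add, one_tmul_real_smul, TensorProduct.tmul_neg]
  generalize (1 : ℂ) ⊗ₜ[ℝ] v = a
  generalize (1 : ℂ) ⊗ₜ[ℝ] (Complex.I • v) = b
  have h1 : (starRingEnd ℂ) c = c.re - c.im * Complex.I := by
    apply Complex.ext <;> simp
  rw [h1]
  have h2 := Complex.I_mul_I
  match_scalars
  · ring
  · linear_combination (c.im / 2 : ℂ) * h2

theorem holVec_add (v w : V) : holVec (v + w) = holVec v + holVec w := by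
  simp only [holVec, smul_add, TensorProduct.tmul_add]
  module

theorem antiholVec_add (v w : V) : antiholVec (v + w) = antiholVec v + antiholVec w := by
  simp only [antiholVec, smul_add, TensorProduct.tmul_add]
  module

theorem holVec_injective : Function.Injective (holVec : V → ℂ ⊗[ℝ] V) := by
  -- The map `c ⊗ v ↦ c • v` is a left inverse, since `(v - i (i v)) / 2 = v`.
  let κ : ℂ ⊗[ℝ] V →ₗ[ℂ] V := (LinearMap.id : V →ₗ[ℝ] V).liftBaseChange ℂ
  have hκ : ∀ v, κ (holVec v) = v := fun v => by
    simp only [κ, holVec, map_smul, map_sub, LinearMap.liftBaseChange_tmul, LinearMap.id_apply,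
      one_smul, smul_smul]
    match_scalars
    linear_combination (-1 / 2 : ℂ) * Complex.I_mul_I
  exact Function.LeftInverse.injective hκ

variable {X : Type*} [TopologicalSpace X] [ChartedSpace V X]

theorem proj10_tmul (x : X) (c : ℂ) (v : V) :
    (proj10 V x (c ⊗ₜ[ℝ] v : ℂ ⊗[ℝ] V) : ℂ ⊗[ℝ] V) = holVec (c • v) := by
  rw [holVec_smul, tmul_eq_smul]
  refine (map_smul (proj10 V x) c _).trans ?_
  congr 1

theorem proj01_tmul (x : X) (c : ℂ) (v : V) :
    (proj01 V x (c ⊗ₜ[ℝ] v : ℂ ⊗[ℝ] V) : ℂ ⊗[ℝ] V) = c • antiholVec v := by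
  rw [tmul_eq_smul]
  refine (map_smul (proj01 V x) c _).trans ?_
  congr 1

theorem proj10_holVec (x : X) (v : V) : (proj10 V x (holVec (V := V) v) : ℂ ⊗[ℝ] V) = holVec v := by
  have h : holVec v = (1 / 2 : ℂ) ⊗ₜ[ℝ] v + (-(1 / 2) * Complex.I) ⊗ₜ[ℝ] (Complex.I • v) := by
    rw [tmul_eq_smul, tmul_eq_smul _ (Complex.I • v), holVec]
    module
  conv_lhs => rw [h]
  refine (map_add (proj10 V x) _ _).trans ?_
  refine (congrArg₂ (· + ·) (proj10_tmul x _ _) (proj10_tmul x _ _)).trans ?_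
  change (holVec ((1 / 2 : ℂ) • v) + holVec ((-(1 / 2) * Complex.I) • Complex.I • v) :
    ℂ ⊗[ℝ] V) = holVec v
  simp only [holVec_smul, smul_smul]
  match_scalars
  linear_combination (-1 / 2 : ℂ) * Complex.I_mul_I

theorem proj10_antiholVec (x : X) (v : V) : (proj10 V x (antiholVec (V := V) v) : ℂ ⊗[ℝ] V) = 0 := by
  have h : antiholVec v = (1 / 2 : ℂ) ⊗ₜ[ℝ] v + (1 / 2 * Complex.I) ⊗ₜ[ℝ] (Complex.I • v) := by
    rw [tmul_eq_smul, tmul_eq_smul _ (Complex.I • v), antiholVec]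
    module
  conv_lhs => rw [h]
  refine (map_add (proj10 V x) _ _).trans ?_
  refine (congrArg₂ (· + ·) (proj10_tmul x _ _) (proj10_tmul x _ _)).trans ?_
  change (holVec ((1 / 2 : ℂ) • v) + holVec ((1 / 2 * Complex.I) • Complex.I • v) :
    ℂ ⊗[ℝ] V) = 0
  simp only [holVec_smul, smul_smul]
  match_scalars
  linear_combination (1 / 2 : ℂ) * Complex.I_mul_I

/-- The complex linear part of a real linear map on `ℂ`. -/
def linPart (A : ℂ →L[ℝ] W) : W := (1 / 2 : ℂ) • (A 1 - Complex.I • A Complex.I)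

/-- The conjugate linear part of a real linear map on `ℂ`. -/
def conjPart (A : ℂ →L[ℝ] W) : W := (1 / 2 : ℂ) • (A 1 + Complex.I • A Complex.I)

theorem apply_eq_linPart_add_conjPart (A : ℂ →L[ℝ] W) (z : ℂ) :
    A z = z • linPart A + (starRingEnd ℂ) z • conjPart A := by
  have hz : z = z.re • (1 : ℂ) + z.im • Complex.I := by
    simp [Complex.re_add_im]
  conv_lhs => rw [hz, map_add, map_smul, map_smul]
  have h1 : (starRingEnd ℂ) z = z.re - z.im * Complex.I := by
    apply Complex.ext <;> simp
  have h2 : ∀ (r : ℝ) (w : W), r • w = (r : ℂ) • w := fun r w => rfl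
  rw [h1, linPart, conjPart, h2, h2]
  nth_rw 3 [← Complex.re_add_im z]
  match_scalars
  · ring
  · linear_combination (z.im : ℂ) * Complex.I_mul_I

/-- The complex linear part of `A` preserves the type of a vector and the conjugate linear part
exchanges the types. -/
theorem baseChange_holVec (A : ℂ →L[ℝ] W) (z : ℂ) :
    (A.toLinearMap.baseChange ℂ) (holVec z) =
      z • (holVec (linPart A) + antiholVec (conjPart A)) := by
  have hz : holVec z = z • holVec (1 : ℂ) := by rw [← holVec_smul, smul_eq_mul, mul_one]
  rw [hz, map_smul]
  congr 1
  simp only [holVec, map_smul, map_sub, LinearMap.baseChange_tmul, ContinuousLinearMap.coe_coe,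
    smul_eq_mul, mul_one, apply_eq_linPart_add_conjPart A, map_one, one_smul, Complex.conj_I,
    neg_smul]
  simp only [TensorProduct.tmul_add, TensorProduct.tmul_neg, antiholVec]
  module

theorem baseChange_antiholVec (A : ℂ →L[ℝ] W) (z : ℂ) :
    (A.toLinearMap.baseChange ℂ) (antiholVec z) =
      (starRingEnd ℂ) z • (antiholVec (linPart A) + holVec (conjPart A)) := by
  have hz : antiholVec z = (starRingEnd ℂ) z • antiholVec (1 : ℂ) := by
    rw [← antiholVec_smul, smul_eq_mul, mul_one]
  rw [hz, map_smul]
  congr 1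
  simp only [antiholVec, map_smul, map_add, LinearMap.baseChange_tmul, ContinuousLinearMap.coe_coe,
    smul_eq_mul, mul_one, apply_eq_linPart_add_conjPart A, map_one, one_smul, Complex.conj_I,
    neg_smul]
  simp only [TensorProduct.tmul_add, TensorProduct.tmul_neg, holVec]
  module

theorem liftBaseChange_holVec (η : V →L[ℝ] ℂ) (v : V) :
    (η.toLinearMap.liftBaseChange ℂ) (holVec v) =
      (1 / 2 : ℂ) * (η v - Complex.I * η (Complex.I • v)) := by
  simp [holVec]

theorem liftBaseChange_antiholVec (η : V →L[ℝ] ℂ) (v : V) :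
    (η.toLinearMap.liftBaseChange ℂ) (antiholVec v) =
      (1 / 2 : ℂ) * (η v + Complex.I * η (Complex.I • v)) := by
  simp only [antiholVec, map_smul, map_add, LinearMap.liftBaseChange_tmul, one_mul, smul_eq_mul,
    ContinuousLinearMap.coe_coe]

theorem exists_proj10_eq_holVec {X : Type*} [TopologicalSpace X] [ChartedSpace V X] (x : X)
    (t : ℂ ⊗[ℝ] V) : ∃ v : V, (proj10 V x t : ℂ ⊗[ℝ] V) = holVec v := by
  induction t with
  | zero => exact ⟨0, (map_zero (proj10 V x)).trans (by simp [holVec]; rfl)⟩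
  | tmul c v => exact ⟨c • v, proj10_tmul x c v⟩
  | add s t hs ht =>
    obtain ⟨v, hv⟩ := hs
    obtain ⟨w, hw⟩ := ht
    exact ⟨v + w, (map_add (proj10 V x) s t).trans
      ((congrArg₂ (· + ·) hv hw).trans (holVec_add v w).symm)⟩

theorem exists_proj01_eq_antiholVec {X : Type*} [TopologicalSpace X] [ChartedSpace V X] (x : X)
    (t : ℂ ⊗[ℝ] V) : ∃ v : V, (proj01 V x t : ℂ ⊗[ℝ] V) = antiholVec v := by
  induction t with
  | zero => exact ⟨0, (map_zero (proj01 V x)).trans (by simp [antiholVec]; rfl)⟩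
  | tmul c v =>
    refine ⟨(starRingEnd ℂ) c • v, (proj01_tmul x c v).trans ?_⟩
    rw [antiholVec_smul, Complex.conj_conj]
  | add s t hs ht =>
    obtain ⟨v, hv⟩ := hs
    obtain ⟨w, hw⟩ := ht
    exact ⟨v + w, (map_add (proj01 V x) s t).trans
      ((congrArg₂ (· + ·) hv hw).trans (antiholVec_add v w).symm)⟩

end Complexification

/-! ### The preferred chart at a point. -/

section Charts

variable {𝕜 : Type*} [NontriviallyNormedField 𝕜] {V : Type*} [NormedAddCommGroup V]
  [NormedSpace 𝕜 V] {X : Type*} [TopologicalSpace X] [ChartedSpace V X]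

/-- The tangent space at `x` is by definition read in this very chart. -/
theorem hasModelDerivAt_chartAt (x : X) :
    HasModelDerivAt 𝕜 (chartAt V x) x (ContinuousLinearMap.id 𝕜 V) := by
  refine ⟨(chartAt V x).continuousAt (mem_chart_source V x), ?_⟩
  refine HasFDerivAt.hasFDerivWithinAt ?_
  refine (hasFDerivAt_id (𝕜 := 𝕜) (chartAt V x x)).congr_of_eventuallyEq ?_
  filter_upwards [(chartAt V x).open_target.mem_nhds (mem_chart_target V x)] with u hu
  exact (chartAt V x).right_inv hu

end Charts

/-! ### Symmetry of mixed second derivatives. -/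

section PartialDerivatives

variable {𝕜 : Type*} [RCLike 𝕜] {E F : Type*} [NormedAddCommGroup E] [NormedSpace 𝕜 E]
  [NormedAddCommGroup F] [NormedSpace 𝕜 F]

/-- The mixed second derivatives of a function of two variables agree. -/
theorem fderiv_fderiv_inr_eq {f : E × E → F} {p : E} (hf : ContDiffAt 𝕜 2 f (p, p)) (x y : E) :
    fderiv 𝕜 (fun u => fderiv 𝕜 f (u, p) ∘L ContinuousLinearMap.inr 𝕜 E E) p x y =
      fderiv 𝕜 (fun u => fderiv 𝕜 f (p, u) ∘L ContinuousLinearMap.inl 𝕜 E E) p y x := by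
  have hd : DifferentiableAt 𝕜 (fderiv 𝕜 f) (p, p) :=
    (hf.fderiv_right (m := 1) (by norm_num)).differentiableAt (by simp)
  have h1 : HasFDerivAt (fun u : E => fderiv 𝕜 f (u, p))
      (fderiv 𝕜 (fderiv 𝕜 f) (p, p) ∘L ContinuousLinearMap.inl 𝕜 E E) p :=
    HasFDerivAt.comp (f := fun u : E => (u, p)) p hd.hasFDerivAt (hasFDerivAt_prodMk_left p p)
  have h2 : HasFDerivAt (fun u : E => fderiv 𝕜 f (p, u))
      (fderiv 𝕜 (fderiv 𝕜 f) (p, p) ∘L ContinuousLinearMap.inr 𝕜 E E) p :=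
    hd.hasFDerivAt.comp p (hasFDerivAt_prodMk_right p p)
  rw [(h1.clm_comp (hasFDerivAt_const _ p)).fderiv, (h2.clm_comp (hasFDerivAt_const _ p)).fderiv]
  have hs : IsSymmSndFDerivAt 𝕜 f (p, p) := hf.isSymmSndFDerivAt (by simp)
  simpa using hs (x, 0) (0, y)

end PartialDerivatives

/-! ### Multiplication and conjugation of a Lie group in the chart at the unit. -/

section ChartMul

variable (𝕜 : Type*) [RCLike 𝕜] {E : Type*} [NormedAddCommGroup E] [NormedSpace 𝕜 E]
  {G : Type*} [TopologicalSpace G] [ChartedSpace E G] [Group G]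

variable (E G) in
/-- The multiplication of a Lie group in the chart at the unit. -/
def chartMul (w : E × E) : E :=
  chartAt E (1 : G) ((chartAt E (1 : G)).symm w.1 * (chartAt E (1 : G)).symm w.2)

variable (E G) in
/-- The conjugation of a Lie group in the chart at the unit. -/
def chartConj (w : E × E) : E :=
  chartAt E (1 : G) ((chartAt E (1 : G)).symm w.1 * (chartAt E (1 : G)).symm w.2 *
    ((chartAt E (1 : G)).symm w.1)⁻¹)

variable (E G) in
/-- The coordinates of the unit. -/
abbrev unitCoord : E := chartAt E (1 : G) 1

theorem chartAt_symm_unitCoord : (chartAt E (1 : G)).symm (unitCoord E G) = 1 :=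
  (chartAt E (1 : G)).left_inv (mem_chart_source E 1)

section

variable [LieGroup 𝓘(𝕜, E) ω G]

theorem contMDiffAt_chartAt_symm_fst : ContMDiffAt 𝓘(𝕜, E × E) 𝓘(𝕜, E) ω
    (fun w : E × E => (chartAt E (1 : G)).symm w.1) (unitCoord E G, unitCoord E G) := by
  have h : ContMDiffAt 𝓘(𝕜, E) 𝓘(𝕜, E) ω (chartAt E (1 : G)).symm (unitCoord E G) :=
    contMDiffOn_chart_symm.contMDiffAt
      ((chartAt E (1 : G)).open_target.mem_nhds (mem_chart_target E 1))
  exact h.comp (unitCoord E G, unitCoord E G) contDiff_fst.contMDiff.contMDiffAt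

theorem contMDiffAt_chartAt_symm_snd : ContMDiffAt 𝓘(𝕜, E × E) 𝓘(𝕜, E) ω
    (fun w : E × E => (chartAt E (1 : G)).symm w.2) (unitCoord E G, unitCoord E G) := by
  have h : ContMDiffAt 𝓘(𝕜, E) 𝓘(𝕜, E) ω (chartAt E (1 : G)).symm (unitCoord E G) :=
    contMDiffOn_chart_symm.contMDiffAt
      ((chartAt E (1 : G)).open_target.mem_nhds (mem_chart_target E 1))
  exact h.comp (unitCoord E G, unitCoord E G) contDiff_snd.contMDiff.contMDiffAt

theorem contMDiffAt_chartAt_one :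
    ContMDiffAt 𝓘(𝕜, E) 𝓘(𝕜, E) ω (chartAt E (1 : G)) 1 :=
  contMDiffOn_chart.contMDiffAt ((chartAt E (1 : G)).open_source.mem_nhds (mem_chart_source E 1))

theorem contDiffAt_chartMul :
    ContDiffAt 𝕜 ω (chartMul E G) (unitCoord E G, unitCoord E G) := by
  rw [← contMDiffAt_iff_contDiffAt]
  refine ContMDiffAt.comp_of_eq (contMDiffAt_chartAt_one 𝕜 (G := G))
    ((contMDiffAt_chartAt_symm_fst 𝕜).mul (contMDiffAt_chartAt_symm_snd 𝕜)) ?_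
  simp

theorem contDiffAt_chartConj :
    ContDiffAt 𝕜 ω (chartConj E G) (unitCoord E G, unitCoord E G) := by
  rw [← contMDiffAt_iff_contDiffAt]
  refine ContMDiffAt.comp_of_eq (contMDiffAt_chartAt_one 𝕜 (G := G))
    (((contMDiffAt_chartAt_symm_fst 𝕜).mul (contMDiffAt_chartAt_symm_snd 𝕜)).mul
      (contMDiffAt_chartAt_symm_fst 𝕜).inv) ?_
  simp

end

variable (E G) in
/-- The differential at the unit of the left translation by the element with coordinates `u`. -/
def leftCoord (u : E) : E →L[𝕜] E :=
  fderiv 𝕜 (chartMul E G) (u, unitCoord E G) ∘L ContinuousLinearMap.inr 𝕜 E E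

variable (E G) in
/-- The differential at the unit of the right translation by the element with coordinates `u`. -/
def rightCoord (u : E) : E →L[𝕜] E :=
  fderiv 𝕜 (chartMul E G) (unitCoord E G, u) ∘L ContinuousLinearMap.inl 𝕜 E E

variable (E G) in
/-- The differential at the unit of the conjugation by the element with coordinates `u`. -/
def conjCoord (u : E) : E →L[𝕜] E :=
  fderiv 𝕜 (chartConj E G) (u, unitCoord E G) ∘L ContinuousLinearMap.inr 𝕜 E E

variable [LieGroup 𝓘(𝕜, E) ω G]

theorem contDiffAt_leftCoord : ContDiffAt 𝕜 ω (leftCoord 𝕜 E G) (unitCoord E G) := by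
  have h := ContDiffAt.comp (f := fun u : E => (u, unitCoord E G)) (unitCoord E G)
    ((contDiffAt_chartMul 𝕜 (E := E) (G := G)).fderiv_right (m := ω) le_rfl)
    (contDiff_prodMk_left (unitCoord E G)).contDiffAt
  exact h.clm_comp contDiffAt_const

theorem contDiffAt_rightCoord : ContDiffAt 𝕜 ω (rightCoord 𝕜 E G) (unitCoord E G) := by
  have h := ((contDiffAt_chartMul 𝕜 (E := E) (G := G)).fderiv_right (m := ω) le_rfl).comp
    (unitCoord E G) (contDiff_prodMk_right (𝕜 := 𝕜) (n := ω) (unitCoord E G)).contDiffAt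
  exact h.clm_comp contDiffAt_const

theorem contDiffAt_conjCoord : ContDiffAt 𝕜 ω (conjCoord 𝕜 E G) (unitCoord E G) := by
  have h := ContDiffAt.comp (f := fun u : E => (u, unitCoord E G)) (unitCoord E G)
    ((contDiffAt_chartConj 𝕜 (E := E) (G := G)).fderiv_right (m := ω) le_rfl)
    (contDiff_prodMk_left (unitCoord E G)).contDiffAt
  exact h.clm_comp contDiffAt_const

theorem eventually_differentiableAt_prodMk {f : E × E → E} {p : E}
    (hf : ContDiffAt 𝕜 ω f (p, p)) :
    (∀ᶠ u in nhds p, DifferentiableAt 𝕜 f (u, p)) ∧ ∀ᶠ u in nhds p, DifferentiableAt 𝕜 f (p, u) := by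
  have h := (hf.of_le (m := 1) (by simp)).eventually (by simp)
  have h1 : Filter.Tendsto (fun u : E => (u, p)) (nhds p) (nhds (p, p)) :=
    (Continuous.prodMk_left p).tendsto p
  have h2 : Filter.Tendsto (fun u : E => (p, u)) (nhds p) (nhds (p, p)) :=
    (Continuous.prodMk_right p).tendsto p
  exact ⟨(h1.eventually h).mono fun u hu => hu.differentiableAt (by simp),
    (h2.eventually h).mono fun u hu => hu.differentiableAt (by simp)⟩

theorem tendsto_chartAt_one :
    Filter.Tendsto (chartAt E (1 : G)) (nhds 1) (nhds (unitCoord E G)) :=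
  (chartAt E (1 : G)).continuousAt (mem_chart_source E 1)

/-- Only elements near the unit are considered: they must lie in the chart domain, and `chartMul` is
known to be differentiable only near the coordinates of the unit. -/
theorem eventually_hasModelDerivAt_mul_left : ∀ᶠ g in nhds (1 : G),
    HasModelDerivAt 𝕜 (fun a : G => chartAt E (1 : G) (g * a)) 1
      (leftCoord 𝕜 E G (chartAt E (1 : G) g)) := by
  have h := (tendsto_chartAt_one (E := E)).eventually
    (eventually_differentiableAt_prodMk 𝕜 (contDiffAt_chartMul 𝕜 (E := E) (G := G))).1
  filter_upwards [h, (chartAt E (1 : G)).open_source.mem_nhds (mem_chart_source E 1)] with g hg hgs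
  have h1 : HasFDerivAt (fun v => chartMul E G (chartAt E (1 : G) g, v))
      (leftCoord 𝕜 E G (chartAt E (1 : G) g)) (unitCoord E G) :=
    hg.hasFDerivAt.comp (unitCoord E G) (hasFDerivAt_prodMk_right _ _)
  have h2 := (hasModelDerivAt_iff_hasFDerivAt.2 h1).comp (hasModelDerivAt_chartAt (1 : G)) rfl
  refine HasModelDerivAt.congr_of_eventuallyEq (f' := leftCoord 𝕜 E G (chartAt E (1 : G) g)) h2 ?_
  filter_upwards [(chartAt E (1 : G)).open_source.mem_nhds (mem_chart_source E 1)] with a ha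
  simp only [chartMul]
  rw [(chartAt E (1 : G)).left_inv hgs, (chartAt E (1 : G)).left_inv ha]

theorem eventually_hasModelDerivAt_mul_right : ∀ᶠ g in nhds (1 : G),
    HasModelDerivAt 𝕜 (fun a : G => chartAt E (1 : G) (a * g)) 1
      (rightCoord 𝕜 E G (chartAt E (1 : G) g)) := by
  have h := (tendsto_chartAt_one (E := E)).eventually
    (eventually_differentiableAt_prodMk 𝕜 (contDiffAt_chartMul 𝕜 (E := E) (G := G))).2
  filter_upwards [h, (chartAt E (1 : G)).open_source.mem_nhds (mem_chart_source E 1)] with g hg hgs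
  have h1 : HasFDerivAt (fun v => chartMul E G (v, chartAt E (1 : G) g))
      (rightCoord 𝕜 E G (chartAt E (1 : G) g)) (unitCoord E G) :=
    HasFDerivAt.comp (f := fun v : E => (v, chartAt E (1 : G) g)) (unitCoord E G) hg.hasFDerivAt
      (hasFDerivAt_prodMk_left _ _)
  have h2 := (hasModelDerivAt_iff_hasFDerivAt.2 h1).comp (hasModelDerivAt_chartAt (1 : G)) rfl
  refine HasModelDerivAt.congr_of_eventuallyEq (f' := rightCoord 𝕜 E G (chartAt E (1 : G) g)) h2 ?_
  filter_upwards [(chartAt E (1 : G)).open_source.mem_nhds (mem_chart_source E 1)] with a ha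
  simp only [chartMul]
  rw [(chartAt E (1 : G)).left_inv hgs, (chartAt E (1 : G)).left_inv ha]

theorem eventually_hasModelDerivAt_conj : ∀ᶠ g in nhds (1 : G),
    HasModelDerivAt 𝕜 (fun a : G => chartAt E (1 : G) (g * a * g⁻¹)) 1
      (conjCoord 𝕜 E G (chartAt E (1 : G) g)) := by
  have h := (tendsto_chartAt_one (E := E)).eventually
    (eventually_differentiableAt_prodMk 𝕜 (contDiffAt_chartConj 𝕜 (E := E) (G := G))).1
  filter_upwards [h, (chartAt E (1 : G)).open_source.mem_nhds (mem_chart_source E 1)] with g hg hgs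
  have h1 : HasFDerivAt (fun v => chartConj E G (chartAt E (1 : G) g, v))
      (conjCoord 𝕜 E G (chartAt E (1 : G) g)) (unitCoord E G) :=
    hg.hasFDerivAt.comp (unitCoord E G) (hasFDerivAt_prodMk_right _ _)
  have h2 := (hasModelDerivAt_iff_hasFDerivAt.2 h1).comp (hasModelDerivAt_chartAt (1 : G)) rfl
  refine HasModelDerivAt.congr_of_eventuallyEq (f' := conjCoord 𝕜 E G (chartAt E (1 : G) g)) h2 ?_
  filter_upwards [(chartAt E (1 : G)).open_source.mem_nhds (mem_chart_source E 1)] with a ha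
  simp only [chartConj]
  rw [(chartAt E (1 : G)).left_inv hgs, (chartAt E (1 : G)).left_inv ha]

theorem leftCoord_unitCoord : leftCoord 𝕜 E G (unitCoord E G) = ContinuousLinearMap.id 𝕜 E := by
  refine (eventually_hasModelDerivAt_mul_left 𝕜 (E := E) (G := G)).self_of_nhds.unique ?_
  simpa only [one_mul] using hasModelDerivAt_chartAt (𝕜 := 𝕜) (1 : G)

theorem rightCoord_unitCoord : rightCoord 𝕜 E G (unitCoord E G) = ContinuousLinearMap.id 𝕜 E := by
  refine (eventually_hasModelDerivAt_mul_right 𝕜 (E := E) (G := G)).self_of_nhds.unique ?_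
  simpa only [mul_one] using hasModelDerivAt_chartAt (𝕜 := 𝕜) (1 : G)

end ChartMul

/-! ### The underlying real Lie group and its Hausdorff property. -/

section LieGroup

variable (E : Type*) [NormedAddCommGroup E] [NormedSpace ℂ E]
  (G : Type*) [TopologicalSpace G] [ChartedSpace E G] [Group G]

/-- The real Lie group underlying a complex Lie group. -/
theorem lieGroup_restrictScalars (n : WithTop ℕ∞) [LieGroup 𝓘(ℂ, E) n G] :
    LieGroup 𝓘(ℝ, E) n G := by
  have := isManifold_restrictScalars (V := E) (X := G) n
  refine { contMDiff_mul := ?_, contMDiff_inv := ?_ }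
  · intro x
    obtain ⟨h1, h2⟩ := contMDiffAt_iff.1 (contMDiff_mul 𝓘(ℂ, E) n (G := G) x)
    exact contMDiffAt_iff.2 ⟨h1, ContDiffWithinAt.restrict_scalars ℝ h2⟩
  · exact contMDiff_restrictScalars (contMDiff_inv 𝓘(ℂ, E) n)

/-- A topological group that is a manifold is Hausdorff. -/
theorem t2Space_of_chartedSpace (E : Type*) [NormedAddCommGroup E] (G : Type*)
    [TopologicalSpace G] [ChartedSpace E G] [Group G] [IsTopologicalGroup G] : T2Space G := by
  -- Points are closed, since the chart at `y` either separates `y` from `x` or has a domain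
  -- avoiding `x`; a T1 topological group is Hausdorff.
  have : T1Space G := by
    refine ⟨fun x => isOpen_compl_iff.1 (isOpen_iff_mem_nhds.2 fun y hy => ?_)⟩
    by_cases hx : x ∈ (chartAt E y).source
    · have h1 : (chartAt E y) y ≠ (chartAt E y) x := fun h =>
        hy ((chartAt E y).injOn (mem_chart_source E y) hx h)
      filter_upwards [((chartAt E y).continuousAt (mem_chart_source E y)).eventually_ne h1]
        with z hz hzx
      exact hz (congrArg _ hzx)
    · filter_upwards [(chartAt E y).open_source.mem_nhds (mem_chart_source E y)] with z hz hzx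
      exact hx (hzx ▸ hz)
  infer_instance

end LieGroup

/-! ### Existence and smoothness of one-parameter subgroups. -/

section OneParameter

variable {E : Type*} [NormedAddCommGroup E] [NormedSpace ℝ E]
  {G : Type*} [TopologicalSpace G] [ChartedSpace E G] [Group G] [LieGroup 𝓘(ℝ, E) ω G]

/-- Left translations carry a left-invariant vector field to itself. -/
theorem isMIntegralCurveOn_mul_left  (v : GroupLieAlgebra 𝓘(ℝ, E) G) (g : G) {γ : ℝ → G}
    {s : Set ℝ} (hγ : IsMIntegralCurveOn (I := 𝓘(ℝ, E)) γ (mulInvariantVectorField v) s) :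
    IsMIntegralCurveOn (I := 𝓘(ℝ, E)) (fun t => g * γ t) (mulInvariantVectorField v) s := by
  intro t ht
  have hsm : ∀ g : G, MDifferentiable 𝓘(ℝ, E) 𝓘(ℝ, E) (fun a : G => g * a) := fun g =>
    (contMDiff_mul_left (I := 𝓘(ℝ, E)) (n := ∞)).mdifferentiable (by simp)
  have h1 := ((hsm g) (γ t)).hasMFDerivAt.comp_hasMFDerivWithinAt t (hγ t ht)
  have h2 : mulInvariantVectorField (I := 𝓘(ℝ, E)) v (g * γ t) =
      mfderiv 𝓘(ℝ, E) 𝓘(ℝ, E) (fun a : G => g * a) (γ t)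
        (mulInvariantVectorField (I := 𝓘(ℝ, E)) v (γ t)) := by
    have h3 : (fun a : G => (g * γ t) * a) = (fun a => g * a) ∘ (fun a => γ t * a) := by
      ext a; simp [mul_assoc]
    unfold mulInvariantVectorField
    rw [h3, mfderiv_comp_of_eq (y := γ t) (hsm g _) (hsm (γ t) 1) (mul_one _)]
    have h4 := mul_one (γ t)
    change (mfderiv 𝓘(ℝ, E) 𝓘(ℝ, E) (fun a : G => g * a) (γ t * 1) : E →L[ℝ] E) _ =
      (mfderiv 𝓘(ℝ, E) 𝓘(ℝ, E) (fun a : G => g * a) (γ t) : E →L[ℝ] E) _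
    rw [h4]
    rfl
  refine HasMFDerivWithinAt.congr_mfderiv h1 (ContinuousLinearMap.ext fun r => ?_)
  let w : E := mulInvariantVectorField (I := 𝓘(ℝ, E)) v (γ t)
  let w' : E := mulInvariantVectorField (I := 𝓘(ℝ, E)) v (g * γ t)
  let A : E →L[ℝ] E := (mfderiv 𝓘(ℝ, E) 𝓘(ℝ, E) (fun a : G => g * a) (γ t) :)
  have h5 : w' = A w := h2
  let c : ℝ := r
  change A (c • w) = c • w'
  rw [h5, map_smul]

variable [CompleteSpace E] in
/-- A homomorphism from the line to a Lie group that is differentiable at `0` is smooth. -/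
theorem contMDiff_of_map_add {γ : ℝ → G} (hadd : ∀ s t, γ (s + t) = γ s * γ t)
    (hd : MDifferentiableAt 𝓘(ℝ, ℝ) 𝓘(ℝ, E) γ 0) : ContMDiff 𝓘(ℝ, ℝ) 𝓘(ℝ, E) ∞ γ := by
  have h0 : γ 0 = 1 := by simpa using hadd 0 0
  have hγ := hasModelDerivAt_of_mdifferentiableAt hd
  set A : ℝ →L[ℝ] E := modelDeriv ℝ γ 0
  have htend : Filter.Tendsto γ (nhds 0) (nhds 1) := h0 ▸ hγ.continuousAt
  -- Since `γ s = γ t * γ (s - t)`, the curve solves in the chart the ordinary differential equation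
  -- whose right-hand side is the left-invariant field.
  have h1 : ∀ᶠ t in nhds (0 : ℝ), HasDerivAt (fun s => chartAt E (1 : G) (γ s))
      (leftCoord ℝ E G (chartAt E (1 : G) (γ t)) (A 1)) t := by
    filter_upwards [htend.eventually (eventually_hasModelDerivAt_mul_left ℝ (E := E) (G := G))]
      with t ht
    have h2 := ht.comp hγ h0
    simp only [← hadd] at h2
    have h3 := (hasModelDerivAt_iff_hasFDerivAt.1 h2).hasDerivAt
    simpa using HasDerivAt.comp_sub_const t t (f := fun s => chartAt E (1 : G) (γ (t + s)))
      (by simpa using h3)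
  have h2 : ∀ᶠ t in nhds (0 : ℝ),
      ContDiffAt ℝ ω (leftCoord ℝ E G) (chartAt E (1 : G) (γ t)) :=
    (tendsto_chartAt_one.comp htend).eventually ((contDiffAt_leftCoord ℝ).eventually (by simp))
  obtain ⟨ε, hε, hball⟩ := Metric.eventually_nhds_iff_ball.1 (h1.and h2)
  have hIcc : ∀ t ∈ Set.Icc (-(ε / 2)) (ε / 2), t ∈ Metric.ball (0 : ℝ) ε := fun t ht => by
    rw [Real.ball_eq_Ioo]
    exact ⟨by linarith [ht.1], by linarith [ht.2]⟩
  have h3 : ContDiffOn ℝ ∞ (fun s => chartAt E (1 : G) (γ s)) (Set.Icc (-(ε / 2)) (ε / 2)) := by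
    -- A solution of an equation with smooth right-hand side is smooth.
    refine ODE.contDiffOn_enat_Icc_of_hasDerivWithinAt (n := ⊤)
      (f := fun _ x => leftCoord ℝ E G x (A 1))
      (u := {x | ContDiffAt ℝ ω (leftCoord ℝ E G) x}) ?_
      (fun t ht => (hball t (hIcc t ht)).1.hasDerivWithinAt) (fun t ht => (hball t (hIcc t ht)).2)
    intro x hx
    have hx2 : ContDiffAt ℝ ω (leftCoord ℝ E G) x.2 := hx.2
    exact (((hx2.of_le (m := ∞) (by simp)).comp x contDiffAt_snd).clm_apply
      contDiffAt_const).contDiffWithinAt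
  have h4 : ContMDiffAt 𝓘(ℝ, ℝ) 𝓘(ℝ, E) ∞ γ 0 := by
    have h5 : ContMDiffAt 𝓘(ℝ, ℝ) 𝓘(ℝ, E) ∞ (fun s => chartAt E (1 : G) (γ s)) 0 :=
      (h3.contDiffAt (Icc_mem_nhds (by linarith) (by linarith))).contMDiffAt
    have h6 : ContMDiffAt 𝓘(ℝ, E) 𝓘(ℝ, E) ∞ (chartAt E (1 : G)).symm (unitCoord E G) :=
      contMDiffOn_chart_symm.contMDiffAt
        ((chartAt E (1 : G)).open_target.mem_nhds (mem_chart_target E 1))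
    refine (ContMDiffAt.comp_of_eq h6 h5 (by rw [h0])).congr_of_eventuallyEq ?_
    filter_upwards [htend.eventually ((chartAt E (1 : G)).open_source.mem_nhds
      (mem_chart_source E 1))] with t ht
    exact ((chartAt E (1 : G)).left_inv ht).symm
  intro t₀
  -- Smoothness at `0` is carried to `t₀` by the homomorphism property.
  have h5 : γ = fun t => γ t₀ * γ (t - t₀) := by
    ext t
    rw [← hadd, add_sub_cancel]
  rw [h5]
  have h6 : ContMDiffAt 𝓘(ℝ, ℝ) 𝓘(ℝ, E) ∞ (fun t : ℝ => γ (t - t₀)) t₀ :=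
    ContMDiffAt.comp_of_eq h4 (contDiff_id.sub contDiff_const).contMDiff.contMDiffAt (sub_self t₀)
  exact contMDiffAt_const.mul h6

variable [CompleteSpace E]

/-- Left-invariant fields are complete: translating an integral curve through the unit gives
integral curves through all points on one common interval `(-ε, ε)`. -/
theorem exists_isMIntegralCurve_mulInvariantVectorField [T2Space G]
    (v : GroupLieAlgebra 𝓘(ℝ, E) G) : ∃ γ : ℝ → G, γ 0 = 1 ∧
      IsMIntegralCurve (I := 𝓘(ℝ, E)) γ (mulInvariantVectorField v) := by
  have hsm : ContMDiff 𝓘(ℝ, E) 𝓘(ℝ, E).tangent 1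
      (fun g => (⟨g, mulInvariantVectorField v g⟩ : TangentBundle 𝓘(ℝ, E) G)) :=
    (contMDiff_mulInvariantVectorField v).of_le (by simp)
  obtain ⟨γ, h0, hγ⟩ := exists_isMIntegralCurveAt_of_contMDiffAt_boundaryless 0 (hsm 1)
  obtain ⟨ε, hε, hγ⟩ := isMIntegralCurveAt_iff'.1 hγ
  refine exists_isMIntegralCurve_of_isMIntegralCurveOn hsm hε (fun g => ⟨fun t => g * γ t, ?_, ?_⟩) 1
  · simp [h0]
  · rw [Real.ball_eq_Ioo, zero_sub, zero_add] at hγ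
    exact isMIntegralCurveOn_mul_left v g hγ

/-- Every element of the Lie algebra is the velocity of a one-parameter subgroup. -/
theorem exists_oneParameterSubgroup [T2Space G] (v : GroupLieAlgebra 𝓘(ℝ, E) G) : ∃ γ : ℝ → G,
      ContMDiff 𝓘(ℝ, ℝ) 𝓘(ℝ, E) ∞ γ ∧ (∀ s t, γ (s + t) = γ s * γ t) ∧
      (mfderiv 𝓘(ℝ, ℝ) 𝓘(ℝ, E) γ 0 : ℝ →L[ℝ] E) 1 = v := by
  have hsm : ContMDiff 𝓘(ℝ, E) 𝓘(ℝ, E).tangent 1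
      (fun g => (⟨g, mulInvariantVectorField v g⟩ : TangentBundle 𝓘(ℝ, E) G)) :=
    (contMDiff_mulInvariantVectorField v).of_le (by simp)
  obtain ⟨γ, h0, hγ⟩ := exists_isMIntegralCurve_mulInvariantVectorField v
  have hadd : ∀ s t, γ (s + t) = γ s * γ t := fun s t => by
    -- Both `t ↦ γ (s + t)` and `t ↦ γ s * γ t` are integral curves starting at `γ s`, so uniqueness
    -- identifies them.
    have h1 : IsMIntegralCurve (I := 𝓘(ℝ, E)) (fun t => γ s * γ t)
        (mulInvariantVectorField v) := by
      rw [isMIntegralCurve_iff_isMIntegralCurveOn] at hγ ⊢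
      exact isMIntegralCurveOn_mul_left v (γ s) hγ
    have h2 := hγ.comp_add s
    have h3 := isMIntegralCurve_Ioo_eq_of_contMDiff_boundaryless (t₀ := 0) hsm h2 h1
      (by simp [h0])
    rw [add_comm]
    exact congrFun h3 t
  refine ⟨γ, contMDiff_of_map_add hadd (hγ 0).mdifferentiableAt, hadd, ?_⟩
  have h1 := (hγ 0).mfderiv
  have h2 : (mfderiv 𝓘(ℝ, ℝ) 𝓘(ℝ, E) γ 0 : ℝ →L[ℝ] E) 1 =
      (1 : ℝ) • (mulInvariantVectorField (I := 𝓘(ℝ, E)) v (γ 0) : E) :=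
    congrArg (fun A : ℝ →L[ℝ] E => A 1) h1
  rw [h2, one_smul, h0]
  have h3 : (fun a : G => 1 * a) = id := by ext; simp
  unfold mulInvariantVectorField
  rw [h3, mfderiv_id]
  rfl

end OneParameter

/-! ### The adjoint representation and its differential. -/

section Adjoint

variable {E : Type*} [NormedAddCommGroup E] [NormedSpace ℂ E]
  {G : Type*} [TopologicalSpace G] [ChartedSpace E G] [Group G]

variable (E) in
/-- The adjoint representation of a complex Lie group. -/
def adjointRep (g : G) : E →L[ℂ] E := modelDeriv ℂ (fun a : G => g * a * g⁻¹) 1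

variable [LieGroup 𝓘(ℂ, E) ω G]

theorem mdifferentiable_mul_left (g : G) :
    MDifferentiable 𝓘(ℂ, E) 𝓘(ℂ, E) (fun a : G => g * a) :=
  (contMDiff_mul_left (I := 𝓘(ℂ, E)) (n := ω)).mdifferentiable (by simp)

theorem mdifferentiable_mul_right (g : G) :
    MDifferentiable 𝓘(ℂ, E) 𝓘(ℂ, E) (fun a : G => a * g) :=
  (contMDiff_mul_right (I := 𝓘(ℂ, E)) (n := ω)).mdifferentiable (by simp)

theorem hasModelDerivAt_conj (g : G) :
    HasModelDerivAt ℂ (fun a : G => g * a * g⁻¹) 1 (adjointRep E g) :=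
  hasModelDerivAt_of_mdifferentiableAt
    ((mdifferentiable_mul_right g⁻¹).comp (mdifferentiable_mul_left g) 1)

theorem adjointRep_one : adjointRep E (1 : G) = ContinuousLinearMap.id ℂ E := by
  refine (hasModelDerivAt_conj (E := E) (1 : G)).unique ?_
  simpa using HasModelDerivAt.id (𝕜 := ℂ) (1 : G)

theorem adjointRep_mul (g h : G) :
    adjointRep E (g * h) = adjointRep E g ∘L adjointRep E h := by
  refine (hasModelDerivAt_conj (E := E) (g * h)).unique ?_
  have h1 := (hasModelDerivAt_conj (E := E) g).comp (hasModelDerivAt_conj (E := E) h)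
    (by simp)
  simpa [mul_assoc] using h1

theorem eventually_adjointRep_eq : ∀ᶠ g in nhds (1 : G),
    adjointRep E g = conjCoord ℂ E G (chartAt E (1 : G) g) := by
  filter_upwards [eventually_hasModelDerivAt_conj ℂ (E := E) (G := G)] with g hg
  have h := (hasModelDerivAt_chartAt (𝕜 := ℂ) (V := E) (1 : G)).comp (hasModelDerivAt_conj (E := E) g)
    (by simp)
  exact (hg.unique h).symm

/-- This is the derivative of `(g a g⁻¹) g = g a` at `a = 1`. -/
theorem eventually_rightCoord_comp_adjointRep : ∀ᶠ g in nhds (1 : G),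
    rightCoord ℂ E G (chartAt E (1 : G) g) ∘L adjointRep E g =
      leftCoord ℂ E G (chartAt E (1 : G) g) := by
  filter_upwards [eventually_hasModelDerivAt_mul_left ℂ (E := E) (G := G),
    eventually_hasModelDerivAt_mul_right ℂ (E := E) (G := G)] with g hl hr
  have h := hr.comp (hasModelDerivAt_conj (E := E) g) (by simp)
  simp only [inv_mul_cancel_right] at h
  exact h.unique hl

theorem contMDiffAt_adjointRep_one :
    ContMDiffAt 𝓘(ℂ, E) 𝓘(ℂ, E →L[ℂ] E) ω (adjointRep E (G := G)) 1 := by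
  have h : ContMDiffAt 𝓘(ℂ, E) 𝓘(ℂ, E →L[ℂ] E) ω (conjCoord ℂ E G) (unitCoord E G) :=
    (contDiffAt_conjCoord ℂ).contMDiffAt
  exact (h.comp 1 (contMDiffAt_chartAt_one ℂ)).congr_of_eventuallyEq eventually_adjointRep_eq

/-- The homomorphism property `Ad(a) = Ad(g) Ad(g⁻¹ a)` carries analyticity from the unit to `g`. -/
theorem contMDiff_adjointRep :
    ContMDiff 𝓘(ℂ, E) 𝓘(ℂ, E →L[ℂ] E) ω (adjointRep E (G := G)) := by
  intro g
  have h1 : adjointRep E (G := G) = fun a => adjointRep E g ∘L adjointRep E (g⁻¹ * a) := by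
    ext1 a
    rw [← adjointRep_mul, mul_inv_cancel_left]
  rw [h1]
  have h2 : ContMDiffAt 𝓘(ℂ, E) 𝓘(ℂ, E →L[ℂ] E) ω (fun a : G => adjointRep E (g⁻¹ * a)) g :=
    ContMDiffAt.comp_of_eq contMDiffAt_adjointRep_one
      (contMDiff_mul_left (I := 𝓘(ℂ, E)) (n := ω)).contMDiffAt (inv_mul_cancel g)
  exact contMDiffAt_const.clm_comp h2

/-- Reduces the bracket of left-invariant fields to a computation in `E`: the pullback composes the
differential of left translation with that of the chart. -/
theorem mpullbackWithin_mulInvariantVectorField_eventuallyEq (y : E) :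
    (VectorField.mpullbackWithin 𝓘(ℂ, E) 𝓘(ℂ, E) (extChartAt 𝓘(ℂ, E) (1 : G)).symm
      (mulInvariantVectorField (I := 𝓘(ℂ, E)) (G := G) y) (Set.range 𝓘(ℂ, E)) : E → E)
      =ᶠ[nhds (unitCoord E G)] fun u => leftCoord ℂ E G u y := by
  have htend : Filter.Tendsto (chartAt E (1 : G)).symm (nhds (unitCoord E G)) (nhds 1) := by
    have h := (chartAt E (1 : G)).continuousAt_symm (mem_chart_target E 1)
    rwa [ContinuousAt, chartAt_symm_unitCoord] at h
  filter_upwards [htend.eventually (eventually_hasModelDerivAt_mul_left ℂ (E := E) (G := G)),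
    (chartAt E (1 : G)).open_target.mem_nhds (mem_chart_target E 1)] with u hu hut
  rw [(chartAt E (1 : G)).right_inv hut] at hu
  have hut' : u ∈ (extChartAt 𝓘(ℂ, E) (1 : G)).target := by simpa using hut
  have hinv := ContinuousLinearMap.inverse_eq
    (mfderivWithin_extChartAt_symm_comp_mfderiv_extChartAt (I := 𝓘(ℂ, E)) hut')
    (mfderiv_extChartAt_comp_mfderivWithin_extChartAt_symm (I := 𝓘(ℂ, E)) hut')
  have h1 : HasModelDerivAt ℂ (chartAt E (1 : G)) ((chartAt E (1 : G)).symm u)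
      (modelDeriv ℂ (extChartAt 𝓘(ℂ, E) (1 : G)) ((extChartAt 𝓘(ℂ, E) (1 : G)).symm u) :
        E →L[ℂ] E) :=
    hasModelDerivAt_of_mdifferentiableAt (mdifferentiableAt_extChartAt (I := 𝓘(ℂ, E))
      ((chartAt E (1 : G)).map_target hut))
  have h2 := h1.comp (hasModelDerivAt_of_mdifferentiableAt
    (mdifferentiable_mul_left (E := E) ((chartAt E (1 : G)).symm u) 1)) (mul_one _)
  rw [VectorField.mpullbackWithin_apply, hinv, hu.unique h2]
  rfl

theorem mlieBracket_one_eq (x y : E) :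
    ((VectorField.mlieBracket 𝓘(ℂ, E) (mulInvariantVectorField (I := 𝓘(ℂ, E)) (G := G) x)
        (mulInvariantVectorField (I := 𝓘(ℂ, E)) (G := G) y) (1 : G) :) : E) =
      fderiv ℂ (leftCoord ℂ E G) (unitCoord E G) x y -
        fderiv ℂ (leftCoord ℂ E G) (unitCoord E G) y x := by
  -- The manifold bracket is the bracket in the chart, transported back by the inverse of the
  -- chart's differential, which is the identity at the unit.
  have hid : (mfderiv 𝓘(ℂ, E) 𝓘(ℂ, E) (extChartAt 𝓘(ℂ, E) (1 : G)) 1 : E →L[ℂ] E) =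
      ContinuousLinearMap.id ℂ E := (hasModelDerivAt_chartAt (𝕜 := ℂ) (V := E) (1 : G)).eq_modelDeriv
  have hset : (extChartAt 𝓘(ℂ, E) (1 : G)).symm ⁻¹' Set.univ ∩ Set.range 𝓘(ℂ, E) = Set.univ := by
    simp
  have hd : HasFDerivAt (leftCoord ℂ E G) (fderiv ℂ (leftCoord ℂ E G) (unitCoord E G))
      (unitCoord E G) := ((contDiffAt_leftCoord ℂ).differentiableAt (by simp)).hasFDerivAt
  have hderiv : ∀ z : E, fderiv ℂ (fun u => leftCoord ℂ E G u z) (unitCoord E G) =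
      (fderiv ℂ (leftCoord ℂ E G) (unitCoord E G)).flip z := fun z => by
    rw [(hd.clm_apply (hasFDerivAt_const z _)).fderiv]
    ext w
    simp
  have key : ∀ X Y : E → E, X =ᶠ[nhds (unitCoord E G)] (fun u => leftCoord ℂ E G u x) →
      Y =ᶠ[nhds (unitCoord E G)] (fun u => leftCoord ℂ E G u y) →
      VectorField.lieBracketWithin ℂ X Y Set.univ (unitCoord E G) =
        fderiv ℂ (leftCoord ℂ E G) (unitCoord E G) x y -
          fderiv ℂ (leftCoord ℂ E G) (unitCoord E G) y x := fun X Y hX hY => by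
    rw [VectorField.lieBracketWithin_univ, hX.lieBracket_vectorField_eq hY,
      VectorField.lieBracket_eq]
    simp only [hderiv, leftCoord_unitCoord, ContinuousLinearMap.flip_apply,
      ContinuousLinearMap.id_apply]
  have hbr : VectorField.lieBracketWithin ℂ
      (VectorField.mpullbackWithin 𝓘(ℂ, E) 𝓘(ℂ, E) (extChartAt 𝓘(ℂ, E) (1 : G)).symm
        (mulInvariantVectorField (I := 𝓘(ℂ, E)) (G := G) x) (Set.range 𝓘(ℂ, E)) : E → E)
      (VectorField.mpullbackWithin 𝓘(ℂ, E) 𝓘(ℂ, E) (extChartAt 𝓘(ℂ, E) (1 : G)).symm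
        (mulInvariantVectorField (I := 𝓘(ℂ, E)) (G := G) y) (Set.range 𝓘(ℂ, E)) : E → E)
      ((extChartAt 𝓘(ℂ, E) (1 : G)).symm ⁻¹' Set.univ ∩ Set.range 𝓘(ℂ, E)) (unitCoord E G) =
      fderiv ℂ (leftCoord ℂ E G) (unitCoord E G) x y -
        fderiv ℂ (leftCoord ℂ E G) (unitCoord E G) y x := by
    rw [hset]
    exact key _ _ (mpullbackWithin_mulInvariantVectorField_eventuallyEq x)
      (mpullbackWithin_mulInvariantVectorField_eventuallyEq y)
  have hinv : (ContinuousLinearMap.id ℂ E).inverse = ContinuousLinearMap.id ℂ E := by simp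
  rw [← hbr]
  refine (congrArg (fun A : E →L[ℂ] E => A.inverse _) hid).trans ?_
  rw [hinv]
  rfl

/-- The differential at the unit of the adjoint representation, in coordinates. -/
theorem hasModelDerivAt_adjointRep :
    HasModelDerivAt ℂ (adjointRep E (G := G)) 1 (fderiv ℂ (leftCoord ℂ E G) (unitCoord E G) -
      (fderiv ℂ (leftCoord ℂ E G) (unitCoord E G)).flip) := by
  have hR : HasFDerivAt (rightCoord ℂ E G) (fderiv ℂ (leftCoord ℂ E G) (unitCoord E G)).flip
      (unitCoord E G) := by
    have h := ((contDiffAt_rightCoord ℂ (E := E) (G := G)).differentiableAt (by simp)).hasFDerivAt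
    -- Left and right translations are the two partial derivatives of the multiplication, so their
    -- derivatives at the unit are its mixed second derivatives in opposite orders.
    have hflip : fderiv ℂ (rightCoord ℂ E G) (unitCoord E G) =
        (fderiv ℂ (leftCoord ℂ E G) (unitCoord E G)).flip := by
      ext x y
      exact (fderiv_fderiv_inr_eq ((contDiffAt_chartMul ℂ (E := E) (G := G)).of_le
        (by simp)) y x).symm
    rwa [hflip] at h
  have hL : HasFDerivAt (leftCoord ℂ E G) (fderiv ℂ (leftCoord ℂ E G) (unitCoord E G))
      (unitCoord E G) := ((contDiffAt_leftCoord ℂ).differentiableAt (by simp)).hasFDerivAt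
  have hA : HasFDerivAt (conjCoord ℂ E G) (fderiv ℂ (conjCoord ℂ E G) (unitCoord E G))
      (unitCoord E G) := ((contDiffAt_conjCoord ℂ).differentiableAt (by simp)).hasFDerivAt
  have hAd := ((hasModelDerivAt_iff_hasFDerivAt.2 hA).comp
    (hasModelDerivAt_chartAt (1 : G)) rfl).congr_of_eventuallyEq eventually_adjointRep_eq
  have htend : Filter.Tendsto (chartAt E (1 : G)).symm (nhds (unitCoord E G)) (nhds 1) := by
    have h := (chartAt E (1 : G)).continuousAt_symm (mem_chart_target E 1)
    rwa [ContinuousAt, chartAt_symm_unitCoord] at h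
  have hprod : (fun u => rightCoord ℂ E G u ∘L conjCoord ℂ E G u)
      =ᶠ[nhds (unitCoord E G)] leftCoord ℂ E G := by
    filter_upwards [htend.eventually (eventually_adjointRep_eq (E := E) (G := G)),
      htend.eventually (eventually_rightCoord_comp_adjointRep (E := E) (G := G)),
      (chartAt E (1 : G)).open_target.mem_nhds (mem_chart_target E 1)] with u h1 h2 h3
    rw [(chartAt E (1 : G)).right_inv h3] at h1 h2
    rw [← h1, h2]
  have hconj : conjCoord ℂ E G (unitCoord E G) = ContinuousLinearMap.id ℂ E := by
    rw [← adjointRep_one (E := E) (G := G)]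
    exact (eventually_adjointRep_eq (E := E) (G := G)).self_of_nhds.symm
  -- Differentiating `R(u) Ad(u) = L(u)` at the unit, where `R` and `Ad` are the identity, gives `dR
  -- + dAd = dL`.
  have h1 := (hR.clm_comp hA).unique (hL.congr_of_eventuallyEq hprod)
  have h2 : fderiv ℂ (conjCoord ℂ E G) (unitCoord E G) =
      fderiv ℂ (leftCoord ℂ E G) (unitCoord E G) -
        (fderiv ℂ (leftCoord ℂ E G) (unitCoord E G)).flip := by
    rw [eq_sub_iff_add_eq]
    refine Eq.trans ?_ h1
    ext x y
    simp [hconj, rightCoord_unitCoord]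
  rw [← h2]
  exact hAd

/-- The differential at the unit of the adjoint representation is the adjoint action of the Lie
algebra. -/
theorem exists_hasModelDerivAt_adjointRep : ∃ A : E →L[ℂ] E →L[ℂ] E,
    HasModelDerivAt ℂ (adjointRep E (G := G)) 1 A ∧
      ∀ x y : E, A x y = (Bracket.bracket (L := GroupLieAlgebra 𝓘(ℂ, E) G)
        (M := GroupLieAlgebra 𝓘(ℂ, E) G) x y : GroupLieAlgebra 𝓘(ℂ, E) G) :=
  ⟨_, hasModelDerivAt_adjointRep, fun x y => (mlieBracket_one_eq x y).symm⟩

end Adjoint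

/-! ### Graph coordinates of subspaces, written in the ring of operators. -/

section OperatorAlgebra

variable {R : Type*} [Ring R]

/-- When `a` is not a unit, neither is `a * b`, and both sides take the default value `0`. -/
theorem ringInverse_mul_of_isUnit_right (a : R) {b : R} (hb : IsUnit b) :
    Ring.inverse (a * b) = Ring.inverse b * Ring.inverse a := by
  obtain ⟨u, rfl⟩ := hb
  by_cases ha : IsUnit a
  · obtain ⟨v, rfl⟩ := ha
    rw [← Units.val_mul, Ring.inverse_unit, Ring.inverse_unit, Ring.inverse_unit, mul_inv_rev,
      Units.val_mul]
  · have h : ¬ IsUnit (a * (u : R)) := by rwa [Units.isUnit_mul_units]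
    rw [Ring.inverse_non_unit _ h, Ring.inverse_non_unit _ ha, mul_zero]

/-- The compression `P A P` of `A`, completed by the identity on the complement. -/
def compression (P A : R) : R := P * A * P + (1 - P)

theorem compression_one {P : R} (hP : P * P = P) : compression P 1 = 1 := by
  simp [compression, hP]

/-- The hypothesis says that `B` preserves the image of `P`, so `B` is block triangular and the
corner block of `A * B` is the product of the corner blocks. -/
theorem compression_mul {P : R} (hP : P * P = P) (A : R) {B : R} (hB : P * B * P = B * P) :
    compression P (A * B) = compression P A * compression P B := by
  have h1 : P * A * P * (P * B * P) = P * (A * B) * P := by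
    rw [hB, mul_assoc (P * A) P, ← mul_assoc P B P, hB]
    simp only [mul_assoc]
  have h2 : P * A * P * (1 - P) = 0 := by rw [mul_sub, mul_one, mul_assoc _ P P, hP, sub_self]
  have h3 : (1 - P) * (P * B * P) = 0 := by
    rw [sub_mul, one_mul, ← mul_assoc, ← mul_assoc, hP, sub_self]
  have h4 : (1 - P) * (1 - P) = 1 - P := by
    rw [sub_mul, one_mul, mul_sub, mul_one, hP, sub_self, sub_zero]
  simp only [compression, add_mul, mul_add, h1, h2, h3, h4]
  abel

/-- If `P` projects onto a subspace `S`, the product `A P (P A P)⁻¹` depends only on `A S`. -/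
def graphMap (P A : R) : R := A * P * Ring.inverse (compression P A)

/-- Here `A * B * P = A * P * compression P B`, and the invertible factor `compression P B` cancels.
No invertibility of `compression P A` is needed, owing to the default value of `Ring.inverse`. -/
theorem graphMap_mul {P : R} (hP : P * P = P) (A : R) {B B' : R} (hB : P * B * P = B * P)
    (hB' : P * B' * P = B' * P) (h1 : B * B' = 1) (h2 : B' * B = 1) :
    graphMap P (A * B) = graphMap P A := by
  have hu : compression P B * compression P B' = 1 := by
    rw [← compression_mul hP B hB', h1, compression_one hP]
  have hu' : compression P B' * compression P B = 1 := by
    rw [← compression_mul hP B' hB, h2, compression_one hP]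
  have hunit : IsUnit (compression P B) := ⟨⟨_, _, hu, hu'⟩, rfl⟩
  have h3 : A * B * P = A * P * compression P B := by
    have : P * compression P B = B * P := by
      rw [compression, mul_add, mul_sub, mul_one, hP, sub_self, add_zero, ← mul_assoc, ← mul_assoc,
        hP, hB]
    rw [mul_assoc A P, this, mul_assoc]
  rw [graphMap, graphMap, compression_mul hP A hB, ringInverse_mul_of_isUnit_right _ hunit, h3,
    ← mul_assoc, mul_assoc (A * P), Ring.mul_inverse_cancel _ hunit, mul_one]

theorem isUnit_compression_mul {P : R} (hP : P * P = P) (A : R) {B B' : R}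
    (hB : P * B * P = B * P) (hB' : P * B' * P = B' * P) (h1 : B * B' = 1) (h2 : B' * B = 1) :
    IsUnit (compression P (A * B)) ↔ IsUnit (compression P A) := by
  have hu : compression P B * compression P B' = 1 := by
    rw [← compression_mul hP B hB', h1, compression_one hP]
  have hu' : compression P B' * compression P B = 1 := by
    rw [← compression_mul hP B' hB, h2, compression_one hP]
  rw [compression_mul hP A hB]
  exact Units.isUnit_mul_units _ ⟨_, _, hu, hu'⟩

end OperatorAlgebra

/-! ### One-parameter groups of operators. -/

section OneParameterOperators

variable {E : Type*} [NormedAddCommGroup E] [NormedSpace ℂ E] [CompleteSpace E]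

/-- A one-parameter group of operators preserves the subspaces preserved by its generator. -/
theorem mem_of_hasDerivAt_zero {A : ℝ → E →L[ℂ] E} {D : E →L[ℂ] E}
    (hadd : ∀ s t, A (s + t) = A s * A t) (h0 : A 0 = 1) (hD : HasDerivAt A D 0)
    {S : Submodule ℂ E} (hS : IsClosed (S : Set E)) (hDS : ∀ y ∈ S, D y ∈ S) (t : ℝ) {y : E}
    (hy : y ∈ S) : A t y ∈ S := by
  have hA : ∀ t, HasDerivAt A (A t * D) t := fun t => by
    have h1 : HasDerivAt (fun s => A t * A s) (A t * D) 0 := hD.const_mul (A t)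
    simp only [← hadd] at h1
    simpa using HasDerivAt.comp_sub_const t t (f := fun s => A (t + s)) (by simpa using h1)
  have hexp : ∀ t : ℝ, HasDerivAt (fun s : ℝ => NormedSpace.exp (s • (-D)))
      ((-D) * NormedSpace.exp (t • (-D))) t := fun t => hasDerivAt_exp_smul_const' (-D) t
  -- This product has derivative zero, which identifies `A t` with `exp (t D)`.
  have hconst : ∀ t, A t * NormedSpace.exp (t • (-D)) = 1 := by
    have h2 : ∀ t, HasDerivAt (fun t => A t * NormedSpace.exp (t • (-D))) 0 t := fun t => by
      have := (hA t).mul (hexp t)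
      have hz : A t * D * NormedSpace.exp (t • (-D)) + A t * (-D * NormedSpace.exp (t • (-D))) = 0 := by
        noncomm_ring
      rw [hz] at this
      exact this
    intro t
    have h3 := is_const_of_deriv_eq_zero (fun s => (h2 s).differentiableAt)
      (fun s => (h2 s).deriv) t 0
    simpa [h0] using h3
  let _ : NormedAlgebra ℚ (E →L[ℂ] E) := NormedAlgebra.restrictScalars ℚ ℂ _
  have hAt : A t = NormedSpace.exp (t • D) := by
    have h4 : NormedSpace.exp (t • (-D)) * NormedSpace.exp (t • D) = 1 := by
      rw [← NormedSpace.exp_add_of_commute, ← smul_add, neg_add_cancel, smul_zero,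
        NormedSpace.exp_zero]
      exact ((Commute.refl D).neg_left.smul_left t).smul_right t
    rw [← mul_one (A t), ← h4, ← mul_assoc, hconst, one_mul]
  have hpow : ∀ n : ℕ, (D ^ n) y ∈ S := fun n => by
    induction n with
    | zero => simpa using hy
    | succ n ih => rw [pow_succ']; exact hDS _ ih
  have hsum := NormedSpace.exp_series_hasSum_exp' (𝕂 := ℝ) (t • D)
  have hsum' := (ContinuousLinearMap.apply ℂ E y).hasSum hsum
  rw [hAt]
  -- The partial sums of the exponential series applied to `y` lie in `S`, which is closed.
  refine hS.mem_of_tendsto hsum' (Filter.Eventually.of_forall fun s => S.sum_mem fun n _ => ?_)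
  have h5 : ((ContinuousLinearMap.apply ℂ E y) ((n.factorial : ℝ)⁻¹ • (t • D) ^ n) : E) =
      (((n.factorial : ℝ)⁻¹ * t ^ n : ℝ) : ℂ) • (D ^ n) y := by
    rw [smul_pow, smul_smul]
    rfl
  rw [h5]
  exact S.smul_mem _ (hpow n)

end OneParameterOperators

/-! ### Functions on `G ⧸ B` and the adjoint action of `B`. -/

section Homogeneous

variable {E : Type*} [NormedAddCommGroup E] [NormedSpace ℂ E] [CompleteSpace E]
  {G : Type*} [TopologicalSpace G] [ChartedSpace E G] [Group G] [LieGroup 𝓘(ℂ, E) ω G]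
  {𝔟 : LieSubalgebra ℂ (GroupLieAlgebra 𝓘(ℂ, E) G)}

theorem exists_oneParameterSubgroup_mem_connectedSubgroup {x : E} (hx : x ∈ 𝔟) :
    ∃ γ : ℝ → G, HasModelDerivAt ℝ γ 0 ((1 : ℝ →L[ℝ] ℝ).smulRight x) ∧
      γ 0 = 1 ∧ ∀ t, γ t ∈ connectedSubgroup E 𝔟 := by
  have := lieGroup_restrictScalars E G ω
  have := topologicalGroup_of_lieGroup 𝓘(ℂ, E) (G := G) ω
  have := t2Space_of_chartedSpace E G
  obtain ⟨γ, hγ, hadd, hv⟩ := exists_oneParameterSubgroup (E := E) (G := G) x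
  have h0 : γ 0 = 1 := by simpa using hadd 0 0
  have hd := hasModelDerivAt_of_mdifferentiableAt (hγ.mdifferentiable (by simp) 0)
  have hd' : HasModelDerivAt ℝ γ 0 ((1 : ℝ →L[ℝ] ℝ).smulRight x) := by
    have h1 : modelDeriv ℝ γ 0 = (1 : ℝ →L[ℝ] ℝ).smulRight x := by
      have hv' : (modelDeriv ℝ γ 0 : ℝ →L[ℝ] E) 1 = x := hv
      ext
      simpa using hv'
    rwa [h1] at hd
  refine ⟨γ, hd', h0, fun t => Subgroup.subset_closure ?_⟩
  have hmul : HasModelDerivAt ℝ (fun s : ℝ => t * s) 0 (t • (1 : ℝ →L[ℝ] ℝ)) := by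
    rw [hasModelDerivAt_iff_hasFDerivAt]
    exact (hasFDerivAt_id (𝕜 := ℝ) (0 : ℝ)).const_mul t
  -- `γ t` is the value at time `1` of `s ↦ γ (t * s)`, whose velocity `t x` is still in `𝔟`.
  refine ⟨((t : ℂ) • x : E), 𝔟.smul_mem (t : ℂ) hx, fun s => γ (t * s), ?_, ?_, ?_, ?_⟩
  · exact hγ.comp (contDiff_const.mul contDiff_id).contMDiff
  · intro s s'
    change γ (t * (s + s')) = γ (t * s) * γ (t * s')
    rw [mul_add, hadd]
  · have h2 := (hd'.comp hmul (by simp)).eq_modelDeriv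
    refine (congrArg (fun A : ℝ →L[ℝ] E => A 1) h2).trans ?_
    simp [realTangent]
    rfl
  · simp

/-- The differential of a function on `G ⧸ B` vanishes on the left translates of the Lie algebra
of `B`. -/
theorem HasModelDerivAt.eq_zero_of_mem {f : G ⧸ connectedSubgroup E 𝔟 → ℂ} {g : G}
    {η : E →L[ℝ] ℂ} (hf : HasModelDerivAt ℝ (fun a : G => f (g * a : G)) 1 η) {x : E}
    (hx : x ∈ 𝔟) : η x = 0 := by
  obtain ⟨γ, hγ, h0, hmem⟩ := exists_oneParameterSubgroup_mem_connectedSubgroup hx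
  have h1 := hf.comp hγ h0
  have h2 : (fun t => f ((g * γ t : G) : G ⧸ connectedSubgroup E 𝔟)) =
      fun _ => f ((g : G) : G ⧸ connectedSubgroup E 𝔟) := by
    ext t
    congr 1
    rw [QuotientGroup.mk_mul_of_mem _ (hmem t)]
  rw [h2] at h1
  have h3 := h1.unique (HasModelDerivAt.const _ _)
  simpa using congrArg (fun A : ℝ →L[ℝ] ℂ => A 1) h3

/-- The adjoint action of `B` preserves the subspaces invariant under the Lie algebra of `B`. -/
theorem adjointRep_apply_mem [FiniteDimensional ℂ E]
    {S : Submodule ℂ (GroupLieAlgebra 𝓘(ℂ, E) G)}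
    (hS : ∀ x ∈ 𝔟, ∀ y ∈ S, ⁅x, y⁆ ∈ S) {b : G} (hb : b ∈ connectedSubgroup E 𝔟) {y : E}
    (hy : y ∈ S) : adjointRep E b y ∈ S := by
  obtain ⟨A, hA, hAbr⟩ := exists_hasModelDerivAt_adjointRep (E := E) (G := G)
  let S' : Submodule ℂ E := S
  -- The operators `Ad(γ t)` form a one-parameter group generated by `ad x`. All times `t` are
  -- allowed because the inverse of a generator `γ 1` is `γ (-1)`.
  have key : ∀ γ : ℝ → G, (∀ s t, γ (s + t) = γ s * γ t) →
      ∀ γ' : ℝ →L[ℝ] E, HasModelDerivAt ℝ γ 0 γ' → ∀ x : E, x ∈ 𝔟 → γ' 1 = x → ∀ t : ℝ, ∀ y ∈ S',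
        adjointRep E (γ t) y ∈ S' := by
    intro γ hadd γ' hγ x hx hxγ t y hy
    have h0 : γ 0 = 1 := by simpa using hadd 0 0
    have h1 := (hasModelDerivAt_iff_hasFDerivAt.1 (hA.restrictScalars.comp hγ h0)).hasDerivAt
    refine mem_of_hasDerivAt_zero (A := fun t => adjointRep E (γ t)) (D := A x)
      (fun s t => ?_) ?_ (hxγ ▸ h1) S'.closed_of_finiteDimensional (fun y hy => ?_) t hy
    · rw [hadd, adjointRep_mul]; rfl
    · rw [h0, adjointRep_one]; rfl
    · rw [hAbr]
      exact hS _ hx _ hy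
  induction hb using Subgroup.closure_induction'' generalizing y with
  | one => rwa [adjointRep_one]
  | mem b hb =>
    obtain ⟨x, hx, γ, hγ, hadd, hv, rfl⟩ := hb
    exact key γ hadd (modelDeriv ℝ γ 0)
      (hasModelDerivAt_of_mdifferentiableAt (hγ.mdifferentiable (by simp) 0)) x hx hv 1 y hy
  | inv_mem b hb =>
    obtain ⟨x, hx, γ, hγ, hadd, hv, rfl⟩ := hb
    have hinv : (γ 1)⁻¹ = γ (-1) := by
      rw [inv_eq_iff_mul_eq_one, ← hadd, add_neg_cancel]
      simpa using hadd 0 0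
    rw [hinv]
    exact key γ hadd (modelDeriv ℝ γ 0)
      (hasModelDerivAt_of_mdifferentiableAt (hγ.mdifferentiable (by simp) 0)) x hx hv (-1) y hy
  | mul a b _ _ ha hb =>
    rw [adjointRep_mul]
    exact ha (hb hy)

/-- The differential of `graphMap P` at the identity. -/
theorem hasFDerivAt_graphMap {R : Type*} [NormedRing R] [NormedAlgebra ℂ R] [CompleteSpace R]
    {P : R} (hP : P * P = P) : ∃ D : R →L[ℂ] R, HasFDerivAt (graphMap P) D 1 ∧
      ∀ T, D T = T * P - P * (P * T * P) := by
  have hc : HasFDerivAt (fun A => compression P A)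
      (ContinuousLinearMap.mulLeftRight ℂ R P P) (1 : R) :=
    ((ContinuousLinearMap.mulLeftRight ℂ R P P).hasFDerivAt).add_const (1 - P)
  have hi : HasFDerivAt (Ring.inverse (M₀ := R))
      (-ContinuousLinearMap.mulLeftRight ℂ R 1 1) (compression P 1) := by
    rw [compression_one hP]
    simpa using hasFDerivAt_ringInverse (𝕜 := ℂ) (1 : Rˣ)
  have hl : HasFDerivAt (fun A : R => A * P) ((ContinuousLinearMap.mul ℂ R).flip P) (1 : R) :=
    ((ContinuousLinearMap.mul ℂ R).flip P).hasFDerivAt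
  have h := hl.mul' (hi.comp (1 : R) hc)
  refine ⟨_, h, fun T => ?_⟩
  simp [compression_one hP, sub_eq_add_neg, add_comm]

/-- Local holomorphic functions on `G ⧸ B` given by the action of `G` on the subspaces of its Lie
algebra. -/
theorem exists_holomorphic_function [FiniteDimensional ℂ E] (g₀ : G) {H : E} (hH : H ∈ 𝔟)
    {ξ : E →L[ℂ] ℂ} (hξ : ∀ x : E, x ∈ 𝔟 → ξ x = 0) :
    ∃ (U : Set (G ⧸ connectedSubgroup E 𝔟)) (h : G ⧸ connectedSubgroup E 𝔟 → ℂ)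
      (η : E →L[ℂ] ℂ), IsOpen U ∧ (g₀ : G ⧸ connectedSubgroup E 𝔟) ∈ U ∧
      ContMDiffOn 𝓘(ℂ, E) 𝓘(ℂ, ℂ) ω (fun g : G => h g)
        {g : G | (g : G ⧸ connectedSubgroup E 𝔟) ∈ U} ∧
      HasModelDerivAt ℂ (fun a : G => h (g₀ * a : G)) 1 η ∧
      ∀ x : E, η x = ξ (Bracket.bracket (L := GroupLieAlgebra 𝓘(ℂ, E) G)
        (M := GroupLieAlgebra 𝓘(ℂ, E) G) x H : GroupLieAlgebra 𝓘(ℂ, E) G) := by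
  let S : Submodule ℂ E := 𝔟.toSubmodule
  -- Any linear projection `P` onto `𝔟` will do; it fixes the complement used for the graph
  -- coordinate.
  obtain ⟨f, hf⟩ := S.subtype.exists_leftInverse_of_injective S.ker_subtype
  let P : E →L[ℂ] E := LinearMap.toContinuousLinearMap (S.subtype ∘ₗ f)
  have hPmem : ∀ x, P x ∈ S := fun x => (f x).2
  have hPid : ∀ x ∈ S, P x = x := fun x hx =>
    congrArg Subtype.val (LinearMap.congr_fun hf ⟨x, hx⟩)
  have hP : P * P = P := ContinuousLinearMap.ext fun x => hPid _ (hPmem x)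
  have hB : ∀ b ∈ connectedSubgroup E 𝔟, P * adjointRep E b * P = adjointRep E b * P :=
    fun b hb => ContinuousLinearMap.ext fun x =>
      hPid _ (adjointRep_apply_mem (S := 𝔟.toSubmodule) (fun x hx y hy => 𝔟.lie_mem hx hy) hb
        (hPmem x))
  have hmulinv : ∀ b : G, adjointRep E b * adjointRep E b⁻¹ = 1 := fun b => by
    rw [ContinuousLinearMap.mul_def, ← adjointRep_mul, mul_inv_cancel, adjointRep_one]
    rfl
  have hinvmul : ∀ b : G, adjointRep E b⁻¹ * adjointRep E b = 1 := fun b => by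
    rw [ContinuousLinearMap.mul_def, ← adjointRep_mul, inv_mul_cancel, adjointRep_one]
    rfl
  -- On `Ω`, the vector paired with `ξ` is the unique element of `Ad(g₀⁻¹ g) 𝔟` with projection `H`;
  -- `Ω` consists of the `g` for which `P` maps that subspace isomorphically onto `𝔟`.
  let F : G → ℂ := fun g => ξ (graphMap P (adjointRep E (g₀⁻¹ * g)) H)
  let Ω : Set G := {g | IsUnit (compression P (adjointRep E (g₀⁻¹ * g)))}
  have hsplit : ∀ g b : G, adjointRep E (g₀⁻¹ * (g * b)) =
      adjointRep E (g₀⁻¹ * g) * adjointRep E b := fun g b => by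
    rw [← mul_assoc, adjointRep_mul]
    rfl
  have hFB : ∀ g : G, ∀ b ∈ connectedSubgroup E 𝔟, F (g * b) = F g := fun g b hb => by
    simp only [F, hsplit]
    rw [graphMap_mul hP _ (hB b hb) (hB b⁻¹ (inv_mem hb)) (hmulinv b) (hinvmul b)]
  have hΩB : ∀ g : G, ∀ b ∈ connectedSubgroup E 𝔟, (g * b ∈ Ω ↔ g ∈ Ω) := fun g b hb => by
    simp only [Ω, Set.mem_ofPred_eq, hsplit]
    exact isUnit_compression_mul hP _ (hB b hb) (hB b⁻¹ (inv_mem hb)) (hmulinv b) (hinvmul b)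
  have hAd : ContMDiff 𝓘(ℂ, E) 𝓘(ℂ, E →L[ℂ] E) ω (fun g : G => adjointRep E (g₀⁻¹ * g)) :=
    contMDiff_adjointRep.comp contMDiff_mul_left
  have hcomp : ContDiff ℂ ω (compression P) :=
    (contDiff_const.mul contDiff_id |>.mul contDiff_const).add contDiff_const
  have hΩ : IsOpen Ω :=
    Units.isOpen.preimage (hcomp.continuous.comp hAd.continuous)
  let h : G ⧸ connectedSubgroup E 𝔟 → ℂ := Quotient.lift F fun a b hab => by
    have hab' := QuotientGroup.leftRel_apply.1 hab
    rw [← hFB a _ hab', mul_inv_cancel_left]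
  have := topologicalGroup_of_lieGroup 𝓘(ℂ, E) (G := G) ω
  -- `Ω` is a union of cosets, so it is the full preimage of its image in the quotient.
  have hpre : {g : G | (g : G ⧸ connectedSubgroup E 𝔟) ∈ QuotientGroup.mk '' Ω} = Ω := by
    ext g
    refine ⟨?_, fun hg => ⟨g, hg, rfl⟩⟩
    rintro ⟨g', hg', hgg'⟩
    rw [← hΩB g' _ (QuotientGroup.eq.1 hgg'), mul_inv_cancel_left] at hg'
    exact hg'
  have hone : adjointRep E (g₀⁻¹ * g₀) = 1 := by
    rw [inv_mul_cancel, adjointRep_one]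
    rfl
  obtain ⟨A, hA, hAbr⟩ := exists_hasModelDerivAt_adjointRep (E := E) (G := G)
  obtain ⟨D, hD, hDeq⟩ := hasFDerivAt_graphMap hP
  let ev : (E →L[ℂ] E) →L[ℂ] ℂ := ξ ∘L ContinuousLinearMap.apply ℂ E H
  refine ⟨QuotientGroup.mk '' Ω, h, ev ∘L D ∘L A, QuotientGroup.isOpenMap_coe _ hΩ, ⟨g₀, ?_, rfl⟩,
    ?_, ?_, fun x => ?_⟩
  · simp only [Ω, Set.mem_ofPred_eq, hone, compression_one hP, isUnit_one]
  · rw [hpre]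
    intro g hg
    obtain ⟨u, hu⟩ : IsUnit (compression P (adjointRep E (g₀⁻¹ * g))) := hg
    have h1 : ContDiffAt ℂ ω (graphMap P) (adjointRep E (g₀⁻¹ * g)) := by
      have h0 : ContDiffAt ℂ ω (fun T : E →L[ℂ] E => T * P) (adjointRep E (g₀⁻¹ * g)) :=
        contDiffAt_id.mul contDiffAt_const
      have h00 : ContDiffAt ℂ ω (fun T : E →L[ℂ] E => Ring.inverse (compression P T))
          (adjointRep E (g₀⁻¹ * g)) :=
        ContDiffAt.comp (g := Ring.inverse) (f := compression P) _
          (by rw [← hu]; exact contDiffAt_ringInverse ℂ u) hcomp.contDiffAt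
      exact h0.mul h00
    have h2 : ContDiffAt ℂ ω (fun T => ev (graphMap P T)) (adjointRep E (g₀⁻¹ * g)) :=
      ev.contDiff.contDiffAt.comp _ h1
    exact (h2.contMDiffAt.comp g (hAd g)).contMDiffWithinAt
  · have h1 : HasFDerivAt (fun T => ev (graphMap P T)) (ev ∘L D) (adjointRep E (1 : G)) := by
      rw [adjointRep_one]
      exact ev.hasFDerivAt.comp _ hD
    have h2 := (hasModelDerivAt_iff_hasFDerivAt.2 h1).comp hA rfl
    have h3 : (fun a : G => h (g₀ * a : G)) = fun a => ev (graphMap P (adjointRep E a)) := by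
      ext a
      change F (g₀ * a) = _
      simp only [F, inv_mul_cancel_left]
      rfl
    rw [h3]
    exact h2
  -- The graph coordinate varies by `⁅x, H⁆ - P ⁅x, H⁆`, and `ξ` kills the second term, which lies
  -- in `𝔟`.
  · have h1 : P H = H := hPid H hH
    have h2 : (ev ∘L D ∘L A) x = ξ (A x (P H)) - ξ (P (P (A x (P H)))) := by
      simp only [ContinuousLinearMap.comp_apply, hDeq]
      simp [ev]
    rw [h2, h1, hξ (P _) (hPmem _), sub_zero, hAbr]

end Homogeneous

/-! ### Homogeneous components and the grading element. -/

namespace Gradation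

variable {L : Type*} [LieRing L] [LieAlgebra ℂ L] (𝒜 : Gradation L)

/-- The homogeneous component of degree `m`. -/
def component (m : ℤ) : L →ₗ[ℂ] L :=
  (𝒜.piece m).subtype ∘ₗ DirectSum.component ℂ ℤ (fun m => 𝒜.piece m) m ∘ₗ
    (LinearEquiv.ofBijective (DirectSum.coeLinearMap 𝒜.piece) 𝒜.isInternal).symm.toLinearMap

theorem component_mem (m : ℤ) (x : L) : 𝒜.component m x ∈ 𝒜.piece m :=
  Subtype.property _

theorem component_of_mem {m : ℤ} {x : L} (hx : x ∈ 𝒜.piece m) (k : ℤ) :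
    𝒜.component k x = if k = m then x else 0 := by
  have h : (LinearEquiv.ofBijective (DirectSum.coeLinearMap 𝒜.piece) 𝒜.isInternal).symm x =
      DirectSum.lof ℂ ℤ (fun m => 𝒜.piece m) m ⟨x, hx⟩ := by
    rw [LinearEquiv.symm_apply_eq]
    exact (DirectSum.coeLinearMap_lof 𝒜.piece m ⟨x, hx⟩).symm
  change ((DirectSum.component ℂ ℤ (fun m => 𝒜.piece m) k
    ((LinearEquiv.ofBijective (DirectSum.coeLinearMap 𝒜.piece) 𝒜.isInternal).symm x) :
      𝒜.piece k) : L) = _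
  rw [h]
  split_ifs with hk
  · subst hk
    rw [DirectSum.component.lof_self]
  · rw [DirectSum.component.of]
    simp [Ne.symm hk]

theorem iSup_piece_eq_top : ⨆ m, 𝒜.piece m = ⊤ :=
  𝒜.isInternal.submodule_iSup_eq_top

/-- Linear maps agree if they agree on homogeneous elements. -/
theorem hom_ext {N : Type*} [AddCommGroup N] [Module ℂ N] {f g : L →ₗ[ℂ] N}
    (h : ∀ m, ∀ x ∈ 𝒜.piece m, f x = g x) : f = g := by
  have h1 : ⨆ m, 𝒜.piece m ≤ LinearMap.eqLocus f g := iSup_le fun m x hx => h m x hx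
  rw [iSup_piece_eq_top] at h1
  exact LinearMap.ext fun x => h1 trivial

theorem mem_of_component {N : Submodule ℂ L} {x : L} (h : ∀ m, 𝒜.component m x ∈ N) : x ∈ N := by
  classical
  set y := (LinearEquiv.ofBijective (DirectSum.coeLinearMap 𝒜.piece) 𝒜.isInternal).symm x with hy
  have hx : x = ∑ m ∈ y.support, (y m : L) := by
    rw [← DFinsupp.sum, ← DirectSum.coeLinearMap_eq_dfinsuppSum, hy]
    exact (LinearEquiv.apply_symm_apply
      (LinearEquiv.ofBijective (DirectSum.coeLinearMap 𝒜.piece) 𝒜.isInternal) x).symm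
  rw [hx]
  exact sum_mem fun m _ => h m

theorem mem_part_iff {S : Set ℤ} {x : L} :
    x ∈ 𝒜.part S ↔ ∀ m, m ∉ S → 𝒜.component m x = 0 := by
  refine ⟨fun hx m hm => ?_, fun h => 𝒜.mem_of_component fun m => ?_⟩
  · have h1 : 𝒜.part S ≤ LinearMap.ker (𝒜.component m) := iSup₂_le fun k hk y hy => by
      rw [LinearMap.mem_ker, 𝒜.component_of_mem hy, if_neg]
      rintro rfl
      exact hm hk
    exact h1 hx
  · by_cases hm : m ∈ S
    · exact (le_iSup₂_of_le m hm le_rfl : 𝒜.piece m ≤ 𝒜.part S) (𝒜.component_mem m x)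
    · rw [h m hm]
      exact zero_mem _

theorem part_mono {S T : Set ℤ} (h : S ⊆ T) : 𝒜.part S ≤ 𝒜.part T :=
  biSup_mono h

theorem part_inf_part (S T : Set ℤ) : 𝒜.part S ⊓ 𝒜.part T = 𝒜.part (S ∩ T) := by
  refine le_antisymm (fun x hx => 𝒜.mem_part_iff.2 fun m hm => ?_)
    (le_inf (𝒜.part_mono Set.inter_subset_left) (𝒜.part_mono Set.inter_subset_right))
  by_cases h : m ∈ S
  · exact 𝒜.mem_part_iff.1 hx.2 m fun h' => hm ⟨h, h'⟩
  · exact 𝒜.mem_part_iff.1 hx.1 m h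

theorem part_pair (m k : ℤ) : 𝒜.part {m, k} = 𝒜.piece m ⊔ 𝒜.piece k := by
  exact iSup_pair

theorem lie_mem_part_of_mem {S T U : Set ℤ} (h : ∀ m ∈ S, ∀ k ∈ T, m + k ∈ U) {x y : L}
    (hx : x ∈ 𝒜.part S) (hy : y ∈ 𝒜.part T) : ⁅x, y⁆ ∈ 𝒜.part U := by
  have h1 : ∀ m ∈ S, ∀ x ∈ 𝒜.piece m, 𝒜.part T ≤
      (𝒜.part U).comap (LieModule.toEnd ℂ L L x : L →ₗ[ℂ] L) := fun m hm x hx =>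
    iSup₂_le fun k hk y hy => (le_iSup₂_of_le (m + k) (h m hm k hk) le_rfl :
      𝒜.piece (m + k) ≤ 𝒜.part U) (𝒜.lie_mem m k x y hx hy)
  have h2 : 𝒜.part S ≤ (𝒜.part U).comap ((LieModule.toEnd ℂ L L : L →ₗ[ℂ] L →ₗ[ℂ] L).flip y) :=
    iSup₂_le fun m hm x hx => h1 m hm x hx hy
  exact h2 hx

/-- The derivation acting on the piece of degree `m` as multiplication by `m`. -/
theorem exists_degree_derivation :
    ∃ D : LieDerivation ℂ L L, ∀ m, ∀ x ∈ 𝒜.piece m, D x = (m : ℂ) • x := by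
  let d : L →ₗ[ℂ] L := (DirectSum.toModule ℂ ℤ L fun m => (m : ℂ) • (𝒜.piece m).subtype) ∘ₗ
    (LinearEquiv.ofBijective (DirectSum.coeLinearMap 𝒜.piece) 𝒜.isInternal).symm.toLinearMap
  have hd : ∀ m, ∀ x ∈ 𝒜.piece m, d x = (m : ℂ) • x := fun m x hx => by
    have h : (LinearEquiv.ofBijective (DirectSum.coeLinearMap 𝒜.piece) 𝒜.isInternal).symm x =
        DirectSum.lof ℂ ℤ (fun m => 𝒜.piece m) m ⟨x, hx⟩ := by
      rw [LinearEquiv.symm_apply_eq]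
      exact (DirectSum.coeLinearMap_lof 𝒜.piece m ⟨x, hx⟩).symm
    change DirectSum.toModule ℂ ℤ L (fun m => (m : ℂ) • (𝒜.piece m).subtype)
      ((LinearEquiv.ofBijective (DirectSum.coeLinearMap 𝒜.piece) 𝒜.isInternal).symm x) = _
    rw [h, DirectSum.toModule_lof]
    rfl
  let ad : L →ₗ[ℂ] L →ₗ[ℂ] L := (LieModule.toEnd ℂ L L : L →ₗ[ℂ] L →ₗ[ℂ] L)
  -- The Leibniz rule is an equality of bilinear maps, so homogeneous arguments suffice, and there
  -- it is the additivity of degrees.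
  have key : ad.compr₂ d = ad.compl₂ d - (ad.compl₂ d).flip :=
    𝒜.hom_ext fun m x hx => 𝒜.hom_ext fun k y hy => by
      change d ⁅x, y⁆ = ⁅x, d y⁆ - ⁅y, d x⁆
      rw [hd _ _ (𝒜.lie_mem m k x y hx hy), hd k y hy, hd m x hx, lie_smul, lie_smul,
        ← lie_skew x y, smul_neg, smul_neg, Int.cast_add, add_smul]
      abel
  exact ⟨⟨d, fun x y => LinearMap.congr_fun₂ key x y⟩, hd⟩

/-- A gradation of a semisimple Lie algebra is defined by an element of degree zero. -/
theorem exists_gradingElement [FiniteDimensional ℂ L] [LieAlgebra.IsSemisimple ℂ L] :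
    ∃ H ∈ 𝒜.piece 0, ∀ m, ∀ x ∈ 𝒜.piece m, ⁅x, H⁆ = -(m : ℂ) • x := by
  obtain ⟨D, hD⟩ := 𝒜.exists_degree_derivation
  -- Semisimplicity enters here: every derivation is inner.
  obtain ⟨H, hH⟩ := LieDerivation.IsKilling.exists_eq_ad D
  have h1 : ∀ m, ∀ x ∈ 𝒜.piece m, ⁅x, H⁆ = -(m : ℂ) • x := fun m x hx => by
    rw [← lie_skew, ← LieDerivation.ad_apply_apply ℂ, hH, hD m x hx, neg_smul]
  refine ⟨H, ?_, h1⟩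
  -- Since `⁅H, H⁆ = 0` while `ad H` multiplies the component of degree `m` by `m`, only the
  -- component of degree `0` of `H` survives.
  have h2 : ∀ m, 𝒜.component m ⁅H, H⁆ = (m : ℂ) • 𝒜.component m H := by
    have h3 : ∀ m x, 𝒜.component m (D x) = (m : ℂ) • 𝒜.component m x := fun m x => by
      refine LinearMap.congr_fun (f := 𝒜.component m ∘ₗ (D : L →ₗ[ℂ] L))
        (g := (m : ℂ) • 𝒜.component m) (𝒜.hom_ext fun k y hy => ?_) x
      change 𝒜.component m (D y) = (m : ℂ) • 𝒜.component m y
      rw [hD k y hy, map_smul, 𝒜.component_of_mem hy]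
      split_ifs with h
      · rw [h]
      · simp
    intro m
    rw [← h3, ← hH, LieDerivation.ad_apply_apply]
  refine 𝒜.mem_of_component fun m => ?_
  by_cases hm : m = 0
  · rw [hm]
    exact 𝒜.component_mem 0 H
  · have h4 := h2 m
    rw [lie_self, map_zero, eq_comm, smul_eq_zero] at h4
    rw [h4.resolve_left (Int.cast_ne_zero.2 hm)]
    exact zero_mem _

/-- The bracket with the grading element detects the parts containing the degree zero. -/
theorem mem_part_of_lie_gradingElement {H : L}
    (hH : ∀ m, ∀ x ∈ 𝒜.piece m, ⁅x, H⁆ = -(m : ℂ) • x) {S : Set ℤ} (hS : 0 ∈ S) {x : L}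
    (hx : ⁅x, H⁆ ∈ 𝒜.part S) : x ∈ 𝒜.part S := by
  rw [mem_part_iff] at hx ⊢
  intro m hm
  have h1 : 𝒜.component m ⁅x, H⁆ = -(m : ℂ) • 𝒜.component m x := by
    refine LinearMap.congr_fun (f := 𝒜.component m ∘ₗ
      (LieModule.toEnd ℂ L L : L →ₗ[ℂ] L →ₗ[ℂ] L).flip H)
      (g := -(m : ℂ) • 𝒜.component m) (𝒜.hom_ext fun k y hy => ?_) x
    change 𝒜.component m ⁅y, H⁆ = -(m : ℂ) • 𝒜.component m y
    rw [hH k y hy, map_smul, 𝒜.component_of_mem hy]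
    split_ifs with h
    · rw [h]
    · simp
  have h2 := hx m hm
  rw [h1, smul_eq_zero, neg_eq_zero, Int.cast_eq_zero] at h2
  -- A degree `m ∉ S` is nonzero because `0 ∈ S`, so the factor `-m` can be cancelled.
  exact h2.resolve_left fun h => hm (h ▸ hS)

end Gradation

/-! ### Cauchy-Riemann equations and coordinate vectors on `M`. -/

section RiemannSurface

variable {M : Type*} [TopologicalSpace M] [ChartedSpace ℂ M]

/-- The Cauchy-Riemann equation. -/
theorem HasModelDerivAt.mdifferentiableAt_iff_conjPart_eq_zero {f : M → ℂ} {p : M}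
    {A : ℂ →L[ℝ] ℂ} (hf : HasModelDerivAt ℝ f p A) :
    MDifferentiableAt 𝓘(ℂ, ℂ) 𝓘(ℂ, ℂ) f p ↔ conjPart A = 0 := by
  refine ⟨fun h => ?_, fun h => ?_⟩
  · have h1 := (hasModelDerivAt_of_mdifferentiableAt h).restrictScalars.unique hf
    rw [← h1, conjPart]
    simp only [ContinuousLinearMap.coe_restrictScalars']
    have h2 : modelDeriv ℂ f p Complex.I = Complex.I • (modelDeriv ℂ f p : ℂ →L[ℂ] ℂ) 1 := by
      rw [← map_smul, smul_eq_mul, mul_one]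
    rw [h2, smul_smul, Complex.I_mul_I]
    simp
  · refine (hf.of_restrictScalars ((1 : ℂ →L[ℂ] ℂ).smulRight (linPart A)) ?_).mdifferentiableAt
    refine ContinuousLinearMap.ext fun z => ?_
    rw [apply_eq_linPart_add_conjPart A z, h]
    simp

/-- Conjugation exchanges the two parts, so antiholomorphy becomes the vanishing of `linPart`. -/
theorem conjPart_conj_comp (A : ℂ →L[ℝ] ℂ) :
    conjPart (Complex.conjCLE.toContinuousLinearMap ∘L A) = (starRingEnd ℂ) (linPart A) := by
  simp only [conjPart, linPart, ContinuousLinearMap.comp_apply, smul_eq_mul, map_mul, map_sub,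
    Complex.conj_I, map_div₀, map_one, map_ofNat]
  simp [sub_eq_add_neg]

theorem linPart_comp {W : Type*} [NormedAddCommGroup W] [NormedSpace ℂ W] (η : W →L[ℂ] ℂ)
    (A : ℂ →L[ℝ] W) : linPart (η.restrictScalars ℝ ∘L A) = η (linPart A) := by
  simp [linPart]

theorem conjPart_comp {W : Type*} [NormedAddCommGroup W] [NormedSpace ℂ W] (η : W →L[ℂ] ℂ)
    (A : ℂ →L[ℝ] W) : conjPart (η.restrictScalars ℝ ∘L A) = η (conjPart A) := by
  simp [conjPart, mul_add]

/-- The coordinate vectors of a holomorphic coordinate at `p` are the multiples of a nonzero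
vector. -/
theorem exists_realCoord_eq_mul [IsManifold 𝓘(ℂ, ℂ) ω M] {e : OpenPartialHomeomorph M ℂ}
    (he : e ∈ IsManifold.maximalAtlas 𝓘(ℂ, ℂ) ω M) {p : M} (hp : p ∈ e.source) :
    ∃ s : ℂ, s ≠ 0 ∧ ∀ a : ℂ, (realCoord e p a : ℂ) = a * s := by
  have h1 : HasModelDerivAt ℂ e p (modelDeriv ℂ e p : ℂ →L[ℂ] ℂ) :=
    hasModelDerivAt_of_mdifferentiableAt
      ((contMDiffAt_of_mem_maximalAtlas he hp).mdifferentiableAt (by simp))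
  have h2 : HasModelDerivAt ℂ e.symm (e p) (modelDeriv ℂ e.symm (e p) : ℂ →L[ℂ] ℂ) :=
    hasModelDerivAt_of_mdifferentiableAt
      ((contMDiffAt_symm_of_mem_maximalAtlas he (e.map_source hp)).mdifferentiableAt (by simp))
  have h3 := (h2.comp h1 rfl).congr_of_eventuallyEq (g := fun x => x)
    (by filter_upwards [e.open_source.mem_nhds hp] with x hx using (e.left_inv hx).symm)
  have h4 := congrArg (fun A : ℂ →L[ℂ] ℂ => A 1) (h3.unique (HasModelDerivAt.id p))
  have hr : ∀ a : ℂ, (realCoord e p a : ℂ) = (modelDeriv ℂ e.symm (e p) : ℂ →L[ℂ] ℂ) a :=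
    fun a => congrArg (fun A : ℂ →L[ℝ] ℂ => A a) h2.restrictScalars.eq_modelDeriv
  have hlin : ∀ a : ℂ, (modelDeriv ℂ e.symm (e p) : ℂ →L[ℂ] ℂ) a =
      a * (modelDeriv ℂ e.symm (e p) : ℂ →L[ℂ] ℂ) 1 := fun a => by
    rw [← smul_eq_mul a, ← map_smul, smul_eq_mul, mul_one]
  refine ⟨(modelDeriv ℂ e.symm (e p) : ℂ →L[ℂ] ℂ) 1, fun h0 => ?_, fun a => (hr a).trans (hlin a)⟩
  change (modelDeriv ℂ e.symm (e p) : ℂ →L[ℂ] ℂ) (modelDeriv ℂ e p 1) = 1 at h4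
  rw [hlin, h0, mul_zero] at h4
  exact zero_ne_one h4

/-- The factor `s` is the derivative of the inverse of `e`, read in the preferred chart at `p`,
which may differ from `e`. Only `s ≠ 0` matters for membership in subspaces. -/
theorem exists_dz_eq [IsManifold 𝓘(ℂ, ℂ) ω M] {e : OpenPartialHomeomorph M ℂ}
    (he : e ∈ IsManifold.maximalAtlas 𝓘(ℂ, ℂ) ω M) {p : M} (hp : p ∈ e.source) :
    ∃ s : ℂ, s ≠ 0 ∧ (dz e p : ℂ ⊗[ℝ] ℂ) = holVec s ∧ (dzbar e p : ℂ ⊗[ℝ] ℂ) = antiholVec s := by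
  obtain ⟨s, hs, h⟩ := exists_realCoord_eq_mul he hp
  have h1 : (realCoord e p 1 : ℂ) = s := (h 1).trans (one_mul s)
  have h2 : (realCoord e p Complex.I : ℂ) = Complex.I • s := h _
  refine ⟨s, hs, ?_, ?_⟩
  · rw [holVec, ← tmul_eq_smul Complex.I]
    exact congrArg₂ (fun u v : ℂ => (1 / 2 : ℂ) • ((1 : ℂ) ⊗ₜ[ℝ] u - Complex.I ⊗ₜ[ℝ] v)) h1 h2
  · rw [antiholVec, ← tmul_eq_smul Complex.I]
    exact congrArg₂ (fun u v : ℂ => (1 / 2 : ℂ) • ((1 : ℂ) ⊗ₜ[ℝ] u + Complex.I ⊗ₜ[ℝ] v)) h1 h2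

end RiemannSurface

/-! ### The left logarithmic derivative and the connection form. -/

section LogarithmicDerivative

variable {E : Type*} [NormedAddCommGroup E] [NormedSpace ℂ E]
  {G : Type*} [TopologicalSpace G] [ChartedSpace E G] [Group G]
  {M : Type*} [TopologicalSpace M] [ChartedSpace ℂ M]

/-- The left logarithmic derivative at `p` of a map into a Lie group. -/
def logDeriv (φ : M → G) (p : M) : ℂ →L[ℝ] E :=
  modelDeriv ℝ (fun x => (φ p)⁻¹ * φ x) p

theorem holVec_mem_map_toHolomorphic {S : Submodule ℂ (GroupLieAlgebra 𝓘(ℂ, E) G)} {x : E} :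
    (holVec (V := E) x : ℂ ⊗[ℝ] E) ∈ S.map (toHolomorphic E : GroupLieAlgebra 𝓘(ℂ, E) G →ₗ[ℂ] _) ↔
      x ∈ S := by
  have h : ∀ y : E, ((toHolomorphic E : GroupLieAlgebra 𝓘(ℂ, E) G →ₗ[ℂ] _) y : ℂ ⊗[ℝ] E) =
      holVec (V := E) y := fun y => (proj10_tmul (1 : G) 1 y).trans (by rw [one_smul])
  refine ⟨?_, fun hx => ⟨x, hx, h x⟩⟩
  rintro ⟨y, hy, hxy⟩
  have h1 : (y : E) = x := holVec_injective (V := E) ((h y).symm.trans hxy)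
  exact h1 ▸ hy

variable [LieGroup 𝓘(ℂ, E) ω G] {φ : M → G}

theorem hasModelDerivAt_mul_left (g a : G) :
    HasModelDerivAt ℂ (fun a : G => g * a) a
      (modelDeriv ℂ (fun a : G => g * a) a : E →L[ℂ] E) :=
  hasModelDerivAt_of_mdifferentiableAt (mdifferentiable_mul_left g a)

theorem hasModelDerivAt_logDeriv (hφ : ContMDiff 𝓘(ℝ, ℂ) 𝓘(ℝ, E) ∞ φ)
    (p : M) :
    HasModelDerivAt ℝ (fun x => (φ p)⁻¹ * φ x) p (logDeriv φ p : ℂ →L[ℝ] E) := by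
  have h1 : HasModelDerivAt ℝ φ p (modelDeriv ℝ φ p : ℂ →L[ℝ] E) :=
    hasModelDerivAt_of_mdifferentiableAt (hφ.mdifferentiable (by simp) p)
  have h2 := (hasModelDerivAt_mul_left (E := E) (φ p)⁻¹ (φ p)).restrictScalars.comp h1 rfl
  exact hasModelDerivAt_of_mdifferentiableAt h2.mdifferentiableAt

/-- Writing `φ x = φ p * ((φ p)⁻¹ * φ x)` moves all differentials to the unit. -/
theorem HasModelDerivAt.comp_logDeriv (hφ : ContMDiff 𝓘(ℝ, ℂ) 𝓘(ℝ, E) ∞ φ)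
    {f : G → ℂ} {p : M} {η : E →L[ℝ] ℂ}
    (hf : HasModelDerivAt ℝ (fun a : G => f (φ p * a)) 1 η) :
    HasModelDerivAt ℝ (fun x => f (φ x)) p (η ∘L logDeriv φ p) := by
  have h := hf.comp (hasModelDerivAt_logDeriv hφ p) (by simp)
  simpa only [mul_inv_cancel_left] using h

theorem connectionForm_eq (hφ : ContMDiff 𝓘(ℝ, ℂ) 𝓘(ℝ, E) ∞ φ)
    (p : M) (t : ℂ ⊗[ℝ] ℂ) :
    (connectionForm φ p t : ℂ ⊗[ℝ] E) =
      proj10 E (1 : G) ((logDeriv φ p : ℂ →L[ℝ] E).toLinearMap.baseChange ℂ t) := by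
  have h1 : HasModelDerivAt ℝ φ p (modelDeriv ℝ φ p : ℂ →L[ℝ] E) :=
    hasModelDerivAt_of_mdifferentiableAt (hφ.mdifferentiable (by simp) p)
  have h2 := (hasModelDerivAt_mul_left (E := E) (φ p)⁻¹ (φ p)).restrictScalars
  have h3 := (h2.comp h1 rfl).unique (hasModelDerivAt_logDeriv hφ p)
  rw [← h3, ← h2.eq_modelDeriv]
  refine congrArg (proj10 E (1 : G)) ?_
  exact (LinearMap.congr_fun (LinearMap.baseChange_comp (A := ℂ)
    (f := (modelDeriv ℝ φ p : ℂ →L[ℝ] E).toLinearMap)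
    (modelDeriv ℝ (fun a : G => (φ p)⁻¹ * a) (φ p) : E →L[ℝ] E).toLinearMap) t).symm

/-- The Maurer-Cartan form keeps only the `(1,0)`-part of the image: on `∂_z` this is the complex
linear part of the logarithmic derivative, on `∂_z̄` the conjugate linear part. -/
theorem connectionForm_holVec (hφ : ContMDiff 𝓘(ℝ, ℂ) 𝓘(ℝ, E) ∞ φ)
    (p : M) (z : ℂ) :
    (connectionForm φ p (holVec z : ℂ ⊗[ℝ] ℂ) : ℂ ⊗[ℝ] E) =
      holVec (z • linPart (logDeriv φ p : ℂ →L[ℝ] E)) := by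
  refine (connectionForm_eq hφ p _).trans ?_
  rw [baseChange_holVec]
  refine (map_smul (proj10 E (1 : G)) z _).trans ?_
  rw [holVec_smul]
  refine congrArg (z • ·) ?_
  refine (map_add (proj10 E (1 : G)) _ _).trans ?_
  exact (congrArg₂ (· + ·) (proj10_holVec _ _) (proj10_antiholVec _ _)).trans (add_zero _)

theorem connectionForm_antiholVec (hφ : ContMDiff 𝓘(ℝ, ℂ) 𝓘(ℝ, E) ∞ φ)
    (p : M) (z : ℂ) :
    (connectionForm φ p (antiholVec z : ℂ ⊗[ℝ] ℂ) : ℂ ⊗[ℝ] E) =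
      holVec ((starRingEnd ℂ) z • conjPart (logDeriv φ p : ℂ →L[ℝ] E)) := by
  refine (connectionForm_eq hφ p _).trans ?_
  rw [baseChange_antiholVec]
  refine (map_smul (proj10 E (1 : G)) _ _).trans ?_
  rw [holVec_smul]
  refine congrArg ((starRingEnd ℂ) z • ·) ?_
  refine (map_add (proj10 E (1 : G)) _ _).trans ?_
  exact (congrArg₂ (· + ·) (proj10_antiholVec _ _) (proj10_holVec _ _)).trans (zero_add _)

/-- The `(1,0)`-vectors at `p` form a complex line, and so do the `(0,1)`-vectors, so it suffices to
test one vector of each type. -/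
theorem gradingCondition_iff [CompleteSpace E] (hφ : ContMDiff 𝓘(ℝ, ℂ) 𝓘(ℝ, E) ∞ φ)
    (𝒜 : Gradation (GroupLieAlgebra 𝓘(ℂ, E) G)) :
    GradingCondition 𝒜 (connectionForm φ) ↔
      ∀ p, linPart (logDeriv φ p : ℂ →L[ℝ] E) ∈ 𝒜.piece (-1) ⊔ 𝒜.piece 0 ∧
        conjPart (logDeriv φ p : ℂ →L[ℝ] E) ∈ 𝒜.piece 0 ⊔ 𝒜.piece 1 := by
  refine ⟨fun h p => ⟨?_, ?_⟩, fun h p t => ⟨?_, ?_⟩⟩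
  · have h1 := (h p (holVec (1 : ℂ))).1
    rw [show (proj10 ℂ p (holVec (1 : ℂ) : ℂ ⊗[ℝ] ℂ)) = (holVec (1 : ℂ) : ℂ ⊗[ℝ] ℂ) from
      proj10_holVec p 1, show connectionForm φ p (holVec (1 : ℂ) : ℂ ⊗[ℝ] ℂ) = _ from
      connectionForm_holVec hφ p 1, one_smul] at h1
    exact holVec_mem_map_toHolomorphic.1 h1
  · have h2 : (proj01 ℂ p ((1 : ℂ) ⊗ₜ[ℝ] (1 : ℂ) : ℂ ⊗[ℝ] ℂ)) =
        (antiholVec (1 : ℂ) : ℂ ⊗[ℝ] ℂ) := (proj01_tmul p 1 1).trans (one_smul ℂ _)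
    have h3 : connectionForm φ p (proj01 ℂ p ((1 : ℂ) ⊗ₜ[ℝ] (1 : ℂ) : ℂ ⊗[ℝ] ℂ)) =
        (holVec (conjPart (logDeriv φ p : ℂ →L[ℝ] E)) : ℂ ⊗[ℝ] E) :=
      (congrArg (connectionForm φ p) h2).trans
        ((connectionForm_antiholVec hφ p 1).trans (by rw [map_one, one_smul]))
    exact holVec_mem_map_toHolomorphic.1
      (h3 ▸ (h p ((1 : ℂ) ⊗ₜ[ℝ] (1 : ℂ) : ℂ ⊗[ℝ] ℂ)).2)
  · obtain ⟨z, hz⟩ := exists_proj10_eq_holVec (V := ℂ) p t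
    rw [show proj10 ℂ p t = (holVec z : ℂ ⊗[ℝ] ℂ) from hz,
      show connectionForm φ p (holVec z : ℂ ⊗[ℝ] ℂ) = _ from connectionForm_holVec hφ p z]
    exact holVec_mem_map_toHolomorphic.2 (Submodule.smul_mem _ _ (h p).1)
  · obtain ⟨z, hz⟩ := exists_proj01_eq_antiholVec (V := ℂ) p t
    rw [show proj01 ℂ p t = (antiholVec z : ℂ ⊗[ℝ] ℂ) from hz,
      show connectionForm φ p (antiholVec z : ℂ ⊗[ℝ] ℂ) = _ from connectionForm_antiholVec hφ p z]
    exact holVec_mem_map_toHolomorphic.2 (Submodule.smul_mem _ _ (h p).2)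

end LogarithmicDerivative

/-! ### Tangent vectors of `G ⧸ B` evaluated on functions. -/

section Evaluation

theorem HasModelDerivAt.derivAlong_eq {V : Type*} [NormedAddCommGroup V] [NormedSpace ℂ V]
    {X : Type*} [TopologicalSpace X] [ChartedSpace V X] {f : X → ℂ} {x : X} {A : V →L[ℝ] ℂ}
    (hf : HasModelDerivAt ℝ f x A) (t : ℂ ⊗[ℝ] V) :
    derivAlong V f x t = A.toLinearMap.liftBaseChange ℂ t := by
  rw [← hf.eq_modelDeriv]
  rfl

theorem liftBaseChange_comp {V W : Type*} [AddCommGroup V] [Module ℝ V] [AddCommGroup W]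
    [Module ℝ W] (η : W →ₗ[ℝ] ℂ) (A : V →ₗ[ℝ] W) (t : ℂ ⊗[ℝ] V) :
    (η ∘ₗ A).liftBaseChange ℂ t = η.liftBaseChange ℂ (A.baseChange ℂ t) := by
  induction t with
  | zero => simp
  | tmul c v => simp
  | add s t hs ht => rw [map_add, map_add, map_add, hs, ht]

variable {E : Type*} [NormedAddCommGroup E] [NormedSpace ℂ E]

/-- With its `antiholVec` counterpart, this shows that differentials of holomorphic functions see
only the `(1,0)`-part. -/
theorem liftBaseChange_restrictScalars_holVec (η : E →L[ℂ] ℂ) (v : E) :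
    (η.restrictScalars ℝ).toLinearMap.liftBaseChange ℂ (holVec v) = η v := by
  rw [liftBaseChange_holVec]
  simp only [ContinuousLinearMap.coe_restrictScalars', map_smul, smul_eq_mul]
  linear_combination (-1 / 2 : ℂ) * η v * Complex.I_mul_I

theorem liftBaseChange_restrictScalars_antiholVec (η : E →L[ℂ] ℂ) (v : E) :
    (η.restrictScalars ℝ).toLinearMap.liftBaseChange ℂ (antiholVec v) = 0 := by
  rw [liftBaseChange_antiholVec]
  simp only [ContinuousLinearMap.coe_restrictScalars', map_smul, smul_eq_mul]
  linear_combination (1 / 2 : ℂ) * η v * Complex.I_mul_I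

variable {G : Type*} [TopologicalSpace G] [ChartedSpace E G] [Group G] [LieGroup 𝓘(ℂ, E) ω G]
  {B : Subgroup G}

theorem hasModelDerivAt_mul_left_of_mem_smoothNear {g : G} {h : G ⧸ B → ℂ}
    (hh : h ∈ smoothNear E (g : G ⧸ B)) : HasModelDerivAt ℝ (fun a : G => h (g * a : G)) 1
      (modelDeriv ℝ (fun a : G => h (g * a : G)) 1 : E →L[ℝ] ℂ) := by
  obtain ⟨U, hU, hg, hh⟩ := hh
  have h1 : HasModelDerivAt ℝ (fun a : G => h a) g
      (modelDeriv ℝ (fun a : G => h a) g : E →L[ℝ] ℂ) :=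
    hasModelDerivAt_of_mdifferentiableAt ((hh.contMDiffAt
      ((hU.preimage QuotientGroup.continuous_mk).mem_nhds hg)).mdifferentiableAt (by simp))
  exact hasModelDerivAt_of_mdifferentiableAt (h1.comp
    (hasModelDerivAt_mul_left (E := E) g 1).restrictScalars (mul_one g)).mdifferentiableAt

theorem pushforward_mk_leftTranslation_toHolomorphic {g : G} {q : G ⧸ B} (hg : (g : G ⧸ B) = q)
    (x : E) (h : smoothNear E q) {η : E →L[ℝ] ℂ}
    (hη : HasModelDerivAt ℝ (fun a : G => h.1 (g * a : G)) 1 η) :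
    (((SmoothMap.mk B).pushforward g q hg ∘ₗ leftTranslation E g ∘ₗ
      (toHolomorphic E : GroupLieAlgebra 𝓘(ℂ, E) G →ₗ[ℂ] _)) x).1 h =
      η.toLinearMap.liftBaseChange ℂ (holVec x) := by
  have h1 : HasModelDerivAt ℝ (fun a : G => h.1 a) g
      (modelDeriv ℝ (fun a : G => h.1 a) g : E →L[ℝ] ℂ) :=
    hasModelDerivAt_of_mdifferentiableAt ((SmoothMap.mk B).mdiff hg h)
  have h2 := (hasModelDerivAt_mul_left (E := E) g 1).restrictScalars
  have h3 := hη.unique (h1.comp h2 (mul_one g))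
  have h4 : ((toHolomorphic E : GroupLieAlgebra 𝓘(ℂ, E) G →ₗ[ℂ] _) x : ℂ ⊗[ℝ] E) =
      holVec (V := E) x := (proj10_tmul (1 : G) 1 x).trans (by rw [one_smul])
  let t : ℂ ⊗[ℝ] E :=
    leftTranslation E g ((toHolomorphic E : GroupLieAlgebra 𝓘(ℂ, E) G →ₗ[ℂ] _) x)
  have h5 : (((SmoothMap.mk B).pushforward g q hg ∘ₗ leftTranslation E g ∘ₗ
      (toHolomorphic E : GroupLieAlgebra 𝓘(ℂ, E) G →ₗ[ℂ] _)) x).1 h =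
      derivAlong E (fun a : G => h.1 a) g t := rfl
  refine h5.trans ((h1.derivAlong_eq t).trans ?_)
  rw [h3, ← h4, ← h2.eq_modelDeriv]
  exact (liftBaseChange_comp _ _ _).symm

/-- The differentials of a function on `G ⧸ B` at two representatives of a point are related by the
adjoint action of `B`. -/
theorem HasModelDerivAt.comp_adjointRep {f : G ⧸ B → ℂ} {g b : G}
    {η : E →L[ℂ] ℂ} (hf : HasModelDerivAt ℂ (fun a : G => f (g * a : G)) 1 η) (hb : b ∈ B) :
    HasModelDerivAt ℂ (fun a : G => f (g * b * a : G)) 1 (η ∘L adjointRep E b) := by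
  have h1 := hf.comp (hasModelDerivAt_conj (E := E) b) (by simp)
  convert h1 using 3 with a
  -- The elements `g (b a b⁻¹)` and `g b a` differ by the right factor `b`, hence define the same
  -- coset.
  rw [← QuotientGroup.mk_mul_of_mem (g * (b * a * b⁻¹)) hb]
  simp [mul_assoc]

theorem HolomorphicFunOn.hasModelDerivAt {U : Set (G ⧸ B)} {f : G ⧸ B → ℂ}
    (hf : HolomorphicFunOn E f U) (hU : IsOpen U) {g : G} (hg : (g : G ⧸ B) ∈ U) :
    HasModelDerivAt ℂ (fun a : G => f (g * a : G)) 1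
      (modelDeriv ℂ (fun a : G => f (g * a : G)) 1 : E →L[ℂ] ℂ) := by
  have h1 : HasModelDerivAt ℂ (fun a : G => f a) g
      (modelDeriv ℂ (fun a : G => f a) g : E →L[ℂ] ℂ) :=
    hasModelDerivAt_of_mdifferentiableAt
      ((hf g hg).mdifferentiableAt ((hU.preimage QuotientGroup.continuous_mk).mem_nhds hg))
  exact hasModelDerivAt_of_mdifferentiableAt (h1.comp
    (hasModelDerivAt_mul_left (E := E) g 1) (mul_one g)).mdifferentiableAt

theorem pushforward_mk_comp_apply {M : Type*} [TopologicalSpace M] [ChartedSpace ℂ M] {φ : M → G}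
    (hφ : ContMDiff 𝓘(ℝ, ℂ) 𝓘(ℝ, E) ∞ φ)
    (hf : SmoothMap E ℂ (fun x => (φ x : G ⧸ B))) (p : M) (t : ℂ ⊗[ℝ] ℂ)
    (h : smoothNear E (φ p : G ⧸ B)) {η : E →L[ℝ] ℂ}
    (hη : HasModelDerivAt ℝ (fun a : G => h.1 (φ p * a : G)) 1 η) :
    (hf.pushforward p (φ p : G ⧸ B) rfl t).1 h = η.toLinearMap.liftBaseChange ℂ
      ((logDeriv φ p : ℂ →L[ℝ] E).toLinearMap.baseChange ℂ t) := by
  have h1 := HasModelDerivAt.comp_logDeriv hφ (f := fun a : G => h.1 a) hη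
  exact (h1.derivAlong_eq t).trans (liftBaseChange_comp _ _ _)

end Evaluation

/-! ### Criteria for holomorphy and for membership in the distribution. -/

section Flag

theorem mem_of_forall_continuousLinearMap {E : Type*} [NormedAddCommGroup E] [NormedSpace ℂ E]
    [FiniteDimensional ℂ E] {S : Submodule ℂ E} {x : E}
    (h : ∀ ξ : E →L[ℂ] ℂ, (∀ y ∈ S, ξ y = 0) → ξ x = 0) : x ∈ S := by
  by_contra hx
  obtain ⟨f, hf, hS⟩ := S.exists_le_ker_of_notMem hx
  exact hf (h (LinearMap.toContinuousLinearMap f) fun y hy => hS hy)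

variable {E : Type*} [NormedAddCommGroup E] [NormedSpace ℂ E] [CompleteSpace E]
  {G : Type*} [TopologicalSpace G] [ChartedSpace E G] [Group G] [LieGroup 𝓘(ℂ, E) ω G]
  {𝔟 : LieSubalgebra ℂ (GroupLieAlgebra 𝓘(ℂ, E) G)}
  {𝔪 : Submodule ℂ (GroupLieAlgebra 𝓘(ℂ, E) G)}
  {M : Type*} [TopologicalSpace M] [ChartedSpace ℂ M] {φ : M → G}

/-- Membership of a tangent vector in the distribution defined by `𝔪`. -/
theorem mem_distribution_iff [FiniteDimensional ℂ E] (h𝔟𝔪 : 𝔟.toSubmodule ≤ 𝔪)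
    (hlie : ∀ x ∈ 𝔟, ∀ y ∈ 𝔪, ⁅x, y⁆ ∈ 𝔪) {H : GroupLieAlgebra 𝓘(ℂ, E) G} (hH : H ∈ 𝔟)
    (hH𝔪 : ∀ x, ⁅x, H⁆ ∈ 𝔪 → x ∈ 𝔪) {g : G} {x y : E} (hy : y ∈ 𝔟) {s : ℂ} (hs : s ≠ 0)
    {D : QTangent E (g : G ⧸ connectedSubgroup E 𝔟)}
    (hD : ∀ (h : smoothNear E (g : G ⧸ connectedSubgroup E 𝔟)) (η : E →L[ℝ] ℂ),
      HasModelDerivAt ℝ (fun a : G => h.1 (g * a : G)) 1 η →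
        D.1 h = s * η.toLinearMap.liftBaseChange ℂ (holVec x + antiholVec y)) :
    D ∈ distribution 𝔪 (g : G ⧸ connectedSubgroup E 𝔟) ↔ x ∈ 𝔪 := by
  have hlieH : ∀ x ∈ 𝔪, ⁅x, H⁆ ∈ 𝔪 := fun x hx => by
    rw [← lie_skew]
    exact neg_mem (hlie H hH x hx)
  refine ⟨fun h => ?_, fun hx => ?_⟩
  · refine hH𝔪 x ?_
    refine mem_of_forall_continuousLinearMap (E := E) (S := 𝔪) fun ξ hξ => ?_
    obtain ⟨U, f, η, hU, hg, hf, hη, hηξ⟩ := exists_holomorphic_function (E := E) g hH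
      (ξ := ξ) (fun x hx => hξ x (h𝔟𝔪 hx))
    have hfU : SmoothFunOn E f U := (contMDiffOn_restrictScalars hf).of_le (by simp)
    let f' : smoothNear E (g : G ⧸ connectedSubgroup E 𝔟) := ⟨f, U, hU, hg, hfU⟩
    -- The test function annihilates the whole distribution: a generator given by `g b` and `y ∈ 𝔪`
    -- yields `ξ ⁅Ad(b) y, H⁆`, which vanishes because `Ad(b)` and the bracket with `H` preserve
    -- `𝔪`.
    have h1 : distribution 𝔪 (g : G ⧸ connectedSubgroup E 𝔟) ≤
        LinearMap.ker ((LinearMap.applyₗ f' : Module.Dual ℂ _ →ₗ[ℂ] ℂ) ∘ₗ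
          (QTangent E (g : G ⧸ connectedSubgroup E 𝔟)).subtype) := by
      refine iSup₂_le fun g' hg' => ?_
      rintro _ ⟨y, hy, rfl⟩
      obtain ⟨b, hb, rfl⟩ : ∃ b ∈ connectedSubgroup E 𝔟, g' = g * b :=
        ⟨g⁻¹ * g', QuotientGroup.eq.1 hg'.symm, by simp⟩
      have h2 := hη.comp_adjointRep hb
      have h3 := pushforward_mk_leftTranslation_toHolomorphic (E := E) hg' y f' h2.restrictScalars
      refine (h3.trans (liftBaseChange_restrictScalars_holVec (η ∘L adjointRep E b) y)).trans ?_
      exact (hηξ _).trans (hξ _ (hlieH _ (adjointRep_apply_mem hlie hb hy)))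
    have h2 := hD f' _ hη.restrictScalars
    have h3 : D.1 f' = 0 := h1 h
    rw [h3, map_add, liftBaseChange_restrictScalars_holVec,
      liftBaseChange_restrictScalars_antiholVec, add_zero, eq_comm, mul_eq_zero] at h2
    exact (hηξ x).symm.trans (h2.resolve_left hs)
  · let D' := ((SmoothMap.mk (connectedSubgroup E 𝔟)).pushforward g g rfl ∘ₗ
      leftTranslation E g ∘ₗ (toHolomorphic E : GroupLieAlgebra 𝓘(ℂ, E) G →ₗ[ℂ] _)) x
    have h1 : D = s • D' := by
      refine Subtype.ext (LinearMap.ext fun h => ?_)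
      have hη := hasModelDerivAt_mul_left_of_mem_smoothNear h.2
      refine (hD h _ hη).trans ?_
      refine Eq.trans ?_ (congrArg (s * ·)
        (pushforward_mk_leftTranslation_toHolomorphic rfl x h hη).symm)
      refine congrArg (s * ·) ?_
      -- For a merely smooth function `η` is only real linear, so both `y` and `i y` must be seen to
      -- lie in `𝔟` for the `(0,1)`-part to vanish.
      have hIy : Complex.I • y ∈ 𝔟.toSubmodule := 𝔟.toSubmodule.smul_mem _ hy
      rw [map_add, liftBaseChange_antiholVec, hη.eq_zero_of_mem hy, hη.eq_zero_of_mem hIy]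
      simp
    rw [h1]
    refine Submodule.smul_mem _ _ ?_
    exact Submodule.mem_iSup_of_mem g (Submodule.mem_iSup_of_mem rfl ⟨x, hx, rfl⟩)

/-- The functions detecting the subspace `𝔟` among the velocities of a curve. -/
theorem mem_of_forall_holomorphicFunOn [FiniteDimensional ℂ E]
    {H : GroupLieAlgebra 𝓘(ℂ, E) G} (hH : H ∈ 𝔟) (hH𝔟 : ∀ x, ⁅x, H⁆ ∈ 𝔟 → x ∈ 𝔟) {g : G} {x : E}
    (h : ∀ (U : Set (G ⧸ connectedSubgroup E 𝔟)) (f : G ⧸ connectedSubgroup E 𝔟 → ℂ)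
      (η : E →L[ℂ] ℂ), IsOpen U → (g : G ⧸ connectedSubgroup E 𝔟) ∈ U → HolomorphicFunOn E f U →
      HasModelDerivAt ℂ (fun a : G => f (g * a : G)) 1 η → η x = 0) : x ∈ 𝔟 := by
  refine hH𝔟 x ?_
  refine mem_of_forall_continuousLinearMap (E := E) (S := 𝔟.toSubmodule) fun ξ hξ => ?_
  obtain ⟨U, f, η, hU, hg, hf, hη, hηξ⟩ := exists_holomorphic_function (E := E) g hH (ξ := ξ) hξ
  exact (hηξ x).symm.trans (h U f η hU hg (hf.mdifferentiableOn (by simp)) hη)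

/-- By the Cauchy-Riemann equation, `f ∘ φ` is holomorphic at `p` iff the differential of `f` kills
`conjPart`. All such differentials vanish on `𝔟`, and jointly they vanish only there. -/
theorem holomorphicMap_mk_comp_iff [FiniteDimensional ℂ E]
    (hφ : ContMDiff 𝓘(ℝ, ℂ) 𝓘(ℝ, E) ∞ φ)
    {H : GroupLieAlgebra 𝓘(ℂ, E) G} (hH : H ∈ 𝔟) (hH𝔟 : ∀ x, ⁅x, H⁆ ∈ 𝔟 → x ∈ 𝔟) :
    HolomorphicMap E ℂ (fun p => (φ p : G ⧸ connectedSubgroup E 𝔟)) ↔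
      ∀ p, conjPart (logDeriv φ p : ℂ →L[ℝ] E) ∈ 𝔟 := by
  have hcont : Continuous (fun p => (φ p : G ⧸ connectedSubgroup E 𝔟)) :=
    QuotientGroup.continuous_mk.comp hφ.continuous
  have key : ∀ p (f : G ⧸ connectedSubgroup E 𝔟 → ℂ) (η : E →L[ℂ] ℂ),
      HasModelDerivAt ℂ (fun a : G => f (φ p * a : G)) 1 η →
      (MDifferentiableAt 𝓘(ℂ, ℂ) 𝓘(ℂ, ℂ) (fun x => f (φ x)) p ↔
        η (conjPart (logDeriv φ p : ℂ →L[ℝ] E)) = 0) := fun p f η hη => by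
    have h1 := HasModelDerivAt.comp_logDeriv hφ (f := fun a : G => f a) hη.restrictScalars
    rw [h1.mdifferentiableAt_iff_conjPart_eq_zero, conjPart_comp]
  refine ⟨fun h p => ?_, fun h => ⟨hcont, fun U hU f hf p hp => ?_⟩⟩
  · refine mem_of_forall_holomorphicFunOn hH hH𝔟 (g := φ p) fun U f η hU hp hf hη => ?_
    exact (key p f η hη).1 ((h.2 U hU f hf p hp).mdifferentiableAt
      ((hU.preimage hcont).mem_nhds hp))
  · have hη := hf.hasModelDerivAt hU hp
    exact ((key p f _ hη).2 (hη.restrictScalars.eq_zero_of_mem (h p))).mdifferentiableWithinAt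

theorem antiholomorphicMap_mk_comp_iff [FiniteDimensional ℂ E]
    (hφ : ContMDiff 𝓘(ℝ, ℂ) 𝓘(ℝ, E) ∞ φ)
    {H : GroupLieAlgebra 𝓘(ℂ, E) G} (hH : H ∈ 𝔟) (hH𝔟 : ∀ x, ⁅x, H⁆ ∈ 𝔟 → x ∈ 𝔟) :
    AntiholomorphicMap E ℂ (fun p => (φ p : G ⧸ connectedSubgroup E 𝔟)) ↔
      ∀ p, linPart (logDeriv φ p : ℂ →L[ℝ] E) ∈ 𝔟 := by
  have hcont : Continuous (fun p => (φ p : G ⧸ connectedSubgroup E 𝔟)) :=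
    QuotientGroup.continuous_mk.comp hφ.continuous
  have key : ∀ p (f : G ⧸ connectedSubgroup E 𝔟 → ℂ) (η : E →L[ℂ] ℂ),
      HasModelDerivAt ℂ (fun a : G => f (φ p * a : G)) 1 η →
      (MDifferentiableAt 𝓘(ℂ, ℂ) 𝓘(ℂ, ℂ) (fun x => (starRingEnd ℂ) (f (φ x))) p ↔
        η (linPart (logDeriv φ p : ℂ →L[ℝ] E)) = 0) := fun p f η hη => by
    have h1 := HasModelDerivAt.comp_logDeriv hφ (f := fun a : G => f a) hη.restrictScalars
    have h2 : HasModelDerivAt ℝ (starRingEnd ℂ) (f (φ p)) Complex.conjCLE.toContinuousLinearMap :=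
      hasModelDerivAt_iff_hasFDerivAt.2 Complex.conjCLE.hasFDerivAt
    rw [(h2.comp h1 rfl).mdifferentiableAt_iff_conjPart_eq_zero, conjPart_conj_comp, linPart_comp,
      map_eq_zero]
  refine ⟨fun h p => ?_, fun h => ⟨hcont, fun U hU f hf p hp => ?_⟩⟩
  · refine mem_of_forall_holomorphicFunOn hH hH𝔟 (g := φ p) fun U f η hU hp hf hη => ?_
    exact (key p f η hη).1 ((h.2 U hU f hf p hp).mdifferentiableAt
      ((hU.preimage hcont).mem_nhds hp))
  · have hη := hf.hasModelDerivAt hU hp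
    exact ((key p f _ hη).2 (hη.restrictScalars.eq_zero_of_mem (h p))).mdifferentiableWithinAt

variable [IsManifold 𝓘(ℂ, ℂ) ω M] [FiniteDimensional ℂ E]

/-- The image of `∂_z` is a nonzero multiple of `holVec` of the linear part plus `antiholVec` of the
conjugate part; the latter projects to zero because the conjugate part lies in `𝔟`. -/
theorem pushforward_dz_mem_distribution_iff (hφ : ContMDiff 𝓘(ℝ, ℂ) 𝓘(ℝ, E) ∞ φ)
    (h𝔟𝔪 : 𝔟.toSubmodule ≤ 𝔪)
    (hlie : ∀ x ∈ 𝔟, ∀ y ∈ 𝔪, ⁅x, y⁆ ∈ 𝔪) {H : GroupLieAlgebra 𝓘(ℂ, E) G} (hH : H ∈ 𝔟)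
    (hH𝔪 : ∀ x, ⁅x, H⁆ ∈ 𝔪 → x ∈ 𝔪)
    (hf : SmoothMap E ℂ (fun x => (φ x : G ⧸ connectedSubgroup E 𝔟)))
    {e : OpenPartialHomeomorph M ℂ} (he : e ∈ IsManifold.maximalAtlas 𝓘(ℂ, ℂ) ω M) {p : M}
    (hp : p ∈ e.source) (h : conjPart (logDeriv φ p : ℂ →L[ℝ] E) ∈ 𝔟) :
    hf.pushforward p (φ p : G ⧸ connectedSubgroup E 𝔟) rfl (dz e p) ∈ distribution 𝔪 _ ↔
      linPart (logDeriv φ p : ℂ →L[ℝ] E) ∈ 𝔪 := by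
  obtain ⟨s, hs, hdz, -⟩ := exists_dz_eq he hp
  refine mem_distribution_iff h𝔟𝔪 hlie hH hH𝔪 h hs fun f η hη => ?_
  refine (pushforward_mk_comp_apply hφ hf p (dz e p) f hη).trans ?_
  refine (congrArg (fun t => η.toLinearMap.liftBaseChange ℂ
    ((logDeriv φ p : ℂ →L[ℝ] E).toLinearMap.baseChange ℂ t)) hdz).trans ?_
  rw [baseChange_holVec, map_smul, smul_eq_mul]

theorem pushforward_dzbar_mem_distribution_iff (hφ : ContMDiff 𝓘(ℝ, ℂ) 𝓘(ℝ, E) ∞ φ)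
    (h𝔟𝔪 : 𝔟.toSubmodule ≤ 𝔪)
    (hlie : ∀ x ∈ 𝔟, ∀ y ∈ 𝔪, ⁅x, y⁆ ∈ 𝔪) {H : GroupLieAlgebra 𝓘(ℂ, E) G} (hH : H ∈ 𝔟)
    (hH𝔪 : ∀ x, ⁅x, H⁆ ∈ 𝔪 → x ∈ 𝔪)
    (hf : SmoothMap E ℂ (fun x => (φ x : G ⧸ connectedSubgroup E 𝔟)))
    {e : OpenPartialHomeomorph M ℂ} (he : e ∈ IsManifold.maximalAtlas 𝓘(ℂ, ℂ) ω M) {p : M}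
    (hp : p ∈ e.source) (h : linPart (logDeriv φ p : ℂ →L[ℝ] E) ∈ 𝔟) :
    hf.pushforward p (φ p : G ⧸ connectedSubgroup E 𝔟) rfl (dzbar e p) ∈ distribution 𝔪 _ ↔
      conjPart (logDeriv φ p : ℂ →L[ℝ] E) ∈ 𝔪 := by
  obtain ⟨s, hs, -, hdz⟩ := exists_dz_eq he hp
  refine mem_distribution_iff h𝔟𝔪 hlie hH hH𝔪 h (s := (starRingEnd ℂ) s)
    ((map_ne_zero _).2 hs) fun f η hη => ?_
  refine (pushforward_mk_comp_apply hφ hf p (dzbar e p) f hη).trans ?_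
  refine (congrArg (fun t => η.toLinearMap.liftBaseChange ℂ
    ((logDeriv φ p : ℂ →L[ℝ] E).toLinearMap.baseChange ℂ t)) hdz).trans ?_
  rw [baseChange_antiholVec, map_smul, smul_eq_mul, add_comm]

end Flag

/-! ### The subspaces of the theorem as intersections and their inclusions. -/

namespace Gradation

variable {L : Type*} [LieRing L] [LieAlgebra ℂ L] (𝒜 : Gradation L)

/-- Splits the condition on the linear part into a half seen on `F₊` (antiholomorphy) and a half
seen on `F₋` (the distribution). -/
theorem mem_piece_neg_one_sup_piece_zero {x : L} :
    x ∈ 𝒜.piece (-1) ⊔ 𝒜.piece 0 ↔ x ∈ 𝒜.bMinus ∧ x ∈ 𝒜.mMinus := by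
  have h : ({-1, 0} : Set ℤ) = {m | m ≤ 0} ∩ {m | -1 ≤ m} := by
    ext m
    simp only [Set.mem_insert_iff, Set.mem_singleton_iff, Set.mem_inter_iff, Set.mem_ofPred_eq]
    omega
  rw [← part_pair, h, ← part_inf_part]
  rfl

theorem mem_piece_zero_sup_piece_one {x : L} :
    x ∈ 𝒜.piece 0 ⊔ 𝒜.piece 1 ↔ x ∈ 𝒜.bPlus ∧ x ∈ 𝒜.mPlus := by
  have h : ({0, 1} : Set ℤ) = {m | 0 ≤ m} ∩ {m | m ≤ 1} := by
    ext m
    simp only [Set.mem_insert_iff, Set.mem_singleton_iff, Set.mem_inter_iff, Set.mem_ofPred_eq]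
    omega
  rw [← part_pair, h, ← part_inf_part]
  rfl

theorem bPlus_le_mMinus : 𝒜.bPlus.toSubmodule ≤ 𝒜.mMinus :=
  𝒜.part_mono fun m hm => by
    simp only [Set.mem_ofPred_eq] at hm ⊢
    omega

theorem bMinus_le_mPlus : 𝒜.bMinus.toSubmodule ≤ 𝒜.mPlus :=
  𝒜.part_mono fun m hm => by
    simp only [Set.mem_ofPred_eq] at hm ⊢
    omega

theorem lie_mem_mMinus : ∀ x ∈ 𝒜.bPlus, ∀ y ∈ 𝒜.mMinus, ⁅x, y⁆ ∈ 𝒜.mMinus :=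
  fun _ hx _ hy => 𝒜.lie_mem_part_of_mem (S := {m | 0 ≤ m}) (fun m hm k hk => by
    simp only [Set.mem_ofPred_eq] at hm hk ⊢
    omega) hx hy

theorem lie_mem_mPlus : ∀ x ∈ 𝒜.bMinus, ∀ y ∈ 𝒜.mPlus, ⁅x, y⁆ ∈ 𝒜.mPlus :=
  fun _ hx _ hy => 𝒜.lie_mem_part_of_mem (S := {m | m ≤ 0}) (fun m hm k hk => by
    simp only [Set.mem_ofPred_eq] at hm hk ⊢
    omega) hx hy

end Gradation

end Toda

end

/-! ### The equivalence. -/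

theorem theorem2p2
    {E : Type*} [NormedAddCommGroup E] [NormedSpace ℂ E] [FiniteDimensional ℂ E] [CompleteSpace E]
    {G : Type*} [TopologicalSpace G] [ChartedSpace E G] [Group G] [LieGroup 𝓘(ℂ, E) ω G]
    [LieAlgebra.IsSemisimple ℂ (GroupLieAlgebra 𝓘(ℂ, E) G)]
    (𝒜 : Toda.Gradation (GroupLieAlgebra 𝓘(ℂ, E) G))
    {M : Type*} [TopologicalSpace M] [ChartedSpace ℂ M] [IsManifold 𝓘(ℂ, ℂ) ω M]
    (φ : M → G) (hφ : ContMDiff 𝓘(ℝ, ℂ) 𝓘(ℝ, E) ∞ φ) :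
    Toda.GradingCondition 𝒜 (Toda.connectionForm φ) ↔
      (Toda.HolomorphicMap E ℂ (Toda.phiMinus 𝒜 φ) ∧
        ∀ z ∈ IsManifold.maximalAtlas 𝓘(ℂ, ℂ) ω M, ∀ p ∈ z.source,
          (Toda.phiMinus_smooth 𝒜 hφ).pushforward p (Toda.phiMinus 𝒜 φ p) rfl (Toda.dz z p) ∈
            Toda.distribution 𝒜.mMinus (Toda.phiMinus 𝒜 φ p)) ∧
      (Toda.AntiholomorphicMap E ℂ (Toda.phiPlus 𝒜 φ) ∧
        ∀ z ∈ IsManifold.maximalAtlas 𝓘(ℂ, ℂ) ω M, ∀ p ∈ z.source,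
          (Toda.phiPlus_smooth 𝒜 hφ).pushforward p (Toda.phiPlus 𝒜 φ p) rfl (Toda.dzbar z p) ∈
            Toda.distribution 𝒜.mPlus (Toda.phiPlus 𝒜 φ p)) := by
  have : FiniteDimensional ℂ (GroupLieAlgebra 𝓘(ℂ, E) G) := inferInstanceAs (FiniteDimensional ℂ E)
  obtain ⟨H, hH0, hH⟩ := 𝒜.exists_gradingElement
  -- This serves all four of `bPlus`, `bMinus`, `mPlus` and `mMinus`, whose degree sets contain `0`.
  have hpart : ∀ S : Set ℤ, 0 ∈ S → ∀ x, ⁅x, H⁆ ∈ 𝒜.part S → x ∈ 𝒜.part S :=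
    fun S hS x hx => 𝒜.mem_part_of_lie_gradingElement hH hS hx
  have hHplus : H ∈ 𝒜.bPlus :=
    (le_iSup₂_of_le 0 (by simp) le_rfl : 𝒜.piece 0 ≤ 𝒜.part {m | 0 ≤ m}) hH0
  have hHminus : H ∈ 𝒜.bMinus :=
    (le_iSup₂_of_le 0 (by simp) le_rfl : 𝒜.piece 0 ≤ 𝒜.part {m | m ≤ 0}) hH0
  have hhol : Toda.HolomorphicMap E ℂ (Toda.phiMinus 𝒜 φ) ↔
      ∀ p, Toda.conjPart (Toda.logDeriv φ p : ℂ →L[ℝ] E) ∈ 𝒜.bPlus :=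
    Toda.holomorphicMap_mk_comp_iff hφ hHplus (hpart _ (by simp))
  have hanti : Toda.AntiholomorphicMap E ℂ (Toda.phiPlus 𝒜 φ) ↔
      ∀ p, Toda.linPart (Toda.logDeriv φ p : ℂ →L[ℝ] E) ∈ 𝒜.bMinus :=
    Toda.antiholomorphicMap_mk_comp_iff hφ hHminus (hpart _ (by simp))
  have hminus : ∀ z ∈ IsManifold.maximalAtlas 𝓘(ℂ, ℂ) ω M, ∀ p ∈ z.source,
      Toda.conjPart (Toda.logDeriv φ p : ℂ →L[ℝ] E) ∈ 𝒜.bPlus →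
      ((Toda.phiMinus_smooth 𝒜 hφ).pushforward p (Toda.phiMinus 𝒜 φ p) rfl (Toda.dz z p) ∈
        Toda.distribution 𝒜.mMinus (Toda.phiMinus 𝒜 φ p) ↔
        Toda.linPart (Toda.logDeriv φ p : ℂ →L[ℝ] E) ∈ 𝒜.mMinus) := fun z hz p hp h =>
    Toda.pushforward_dz_mem_distribution_iff hφ 𝒜.bPlus_le_mMinus 𝒜.lie_mem_mMinus hHplus
      (hpart _ (by simp)) (Toda.phiMinus_smooth 𝒜 hφ) hz hp h
  have hplus : ∀ z ∈ IsManifold.maximalAtlas 𝓘(ℂ, ℂ) ω M, ∀ p ∈ z.source,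
      Toda.linPart (Toda.logDeriv φ p : ℂ →L[ℝ] E) ∈ 𝒜.bMinus →
      ((Toda.phiPlus_smooth 𝒜 hφ).pushforward p (Toda.phiPlus 𝒜 φ p) rfl (Toda.dzbar z p) ∈
        Toda.distribution 𝒜.mPlus (Toda.phiPlus 𝒜 φ p) ↔
        Toda.conjPart (Toda.logDeriv φ p : ℂ →L[ℝ] E) ∈ 𝒜.mPlus) := fun z hz p hp h =>
    Toda.pushforward_dzbar_mem_distribution_iff hφ 𝒜.bMinus_le_mPlus 𝒜.lie_mem_mPlus hHminus
      (hpart _ (by simp)) (Toda.phiPlus_smooth 𝒜 hφ) hz hp h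
  rw [Toda.gradingCondition_iff hφ 𝒜, hhol, hanti]
  refine ⟨fun h => ?_, fun ⟨⟨h1, h2⟩, h3, h4⟩ p => ⟨?_, ?_⟩⟩
  · have ha := fun p => 𝒜.mem_piece_neg_one_sup_piece_zero.1 (h p).1
    have hb := fun p => 𝒜.mem_piece_zero_sup_piece_one.1 (h p).2
    exact ⟨⟨fun p => (hb p).1, fun z hz p hp => (hminus z hz p hp (hb p).1).2 (ha p).2⟩,
      fun p => (ha p).1, fun z hz p hp => (hplus z hz p hp (ha p).1).2 (hb p).2⟩
  -- One holomorphic coordinate around `p` suffices; the preferred chart is taken.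
  · have hz := IsManifold.chart_mem_maximalAtlas (I := 𝓘(ℂ, ℂ)) (n := ω) p
    have hp := mem_chart_source ℂ p
    exact 𝒜.mem_piece_neg_one_sup_piece_zero.2
      ⟨h3 p, (hminus _ hz p hp (h1 p)).1 (h2 _ hz p hp)⟩
  · have hz := IsManifold.chart_mem_maximalAtlas (I := 𝓘(ℂ, ℂ)) (n := ω) p
    have hp := mem_chart_source ℂ p
    exact 𝒜.mem_piece_zero_sup_piece_one.2
      ⟨h1 p, (hplus _ hz p hp (h3 p)).1 (h4 _ hz p hp)⟩
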